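/- An igraph is a complete graph on a finite vertex set, each of whose edges is coloured red, blue or green. For an igraph $C$ let $C_r$ be the graph of edges that are red or green and $C_b$ the graph of edges that are blue or green. $C$ contains a graph $H$ if there is an injection $V(H)\to V(C)$ mapping edges of $H$ to edges of $C_r$ and non-adjacent pairs of distinct vertices of $H$ to edges of $C_b$; otherwise $C$ is $H$-free. For $p\in(0,1)$ put $w_p(C)=p|C_r|+(1-p)|C_b|$, let $\mathrm{kex}_p(H,n)$ be the maximum of $w_p(C)$ over all $H$-free igraphs $C$ on $n$ vertices, and let $\kappa_p(H)=\lim_{n\to\infty}\binom n2^{-1}\mathrm{kex}_p(H,n)$. A type $\tau$ is a (nonempty) igraph in which, moreover, every vertex is coloured red or blue. The blowup $m\times\tau$ is the igraph obtained by replacing each vertex $u$ by a part $V_u$ of $m$ vertices, where edges inside $V_u$ get the colour of $u$ and edges between $V_u$ and $V_v$ get the colour of $uv$. $\tau$ describes $H$ if $m\times\tau$ contains $H$ for some $m$. Let $W_p(\tau)$ be the symmetric matrix indexed by $V(\tau)$ whose entries off the diagonal are $p$, $1-p$, $1$ for red, blue, green edges, and whose diagonal entries are $p$, $1-p$ for red,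 blue vertices. The $p$-value of $\tau$ is $\lambda_p(\tau)=\max x^TW_p(\tau)x$ over all $x\in\mathbb R^{V(\tau)}$ with $x\ge 0$ and $\sum_u x_u=1$. $\tau$ is $p$-core if no subtype induced on a nonempty proper subset of its vertices has the same $p$-value. Let $\tau(x,y)$ be the type with $x$ red vertices, $y$ blue vertices and all edges green, and let $I_{a,b}=K_{a+b}\setminus K_b$ be the complete graph on $a+b$ vertices minus all edges inside a set of $b$ vertices. **Lemma.** Let $a,b\ge2$ be integers and let $p\in(0,1)$. Every type whose $p$-value is maximum among the $p$-core types that do not describe $I_{a,b}$ is (up to isomorphism) $\tau(0,a)$ or $\tau(b-1,0)$. Moreover, $$\kappa_p(I_{a,b})=\lim_{n\to\infty}\binom n2^{-1}\mathrm{kex}_p(I_{a,b},n)=\max\left\{1-\frac pa,\;1-\frac{1-p}{b-1}\right\}.$$ -/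

import Mathlib

/-- The three edge colours of an igraph. -/
inductive EdgeColour
  | red
  | blue
  | green

/-- The two vertex colours of a type. -/
inductive VertexColour
  | red
  | blue

/-- An igraph on `V`: a complete graph whose edges are coloured red, blue or green.
Only the values `colour u v` with `u ≠ v` are meaningful; every notion below ignores the diagonal. -/
structure Igraph (V : Type*) where
  colour : V → V → EdgeColour
  symm : ∀ u v, colour u v = colour v u

namespace Igraph

/-- The graph `C_r` of edges that are red in the two-coloured viewpoint (red or green). -/
def redGraph {V : Type*} (C : Igraph V) : SimpleGraph V where
  Adj u v := u ≠ v ∧ (C.colour u v = .red ∨ C.colour u v = .green)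
  symm := ⟨fun u v h => ⟨h.1.symm, by rw [C.symm v u]; exact h.2⟩⟩
  loopless := ⟨fun _ h => h.1 rfl⟩

/-- The graph `C_b` of edges that are blue in the two-coloured viewpoint (blue or green). -/
def blueGraph {V : Type*} (C : Igraph V) : SimpleGraph V where
  Adj u v := u ≠ v ∧ (C.colour u v = .blue ∨ C.colour u v = .green)
  symm := ⟨fun u v h => ⟨h.1.symm, by rw [C.symm v u]; exact h.2⟩⟩
  loopless := ⟨fun _ h => h.1 rfl⟩

/-- `C` contains `H`: the vertices of `H` can be identified with vertices of `C` so that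
`H ⊆ C_r` and the complement of `H` is contained in `C_b`. -/
def Contains {V U : Type*} (C : Igraph V) (H : SimpleGraph U) : Prop :=
  ∃ f : U ↪ V, (∀ u v, H.Adj u v → C.redGraph.Adj (f u) (f v)) ∧
    (∀ u v, Hᶜ.Adj u v → C.blueGraph.Adj (f u) (f v))

/-- The `p`-weight `w_p(C) = p |C_r| + (1 - p) |C_b|`. -/
noncomputable def pWeight {V : Type*} (p : ℝ) (C : Igraph V) : ℝ :=
  p * (C.redGraph.edgeSet.ncard : ℝ) + (1 - p) * (C.blueGraph.edgeSet.ncard : ℝ)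

end Igraph

/-- `kex_p(H, n)`: the maximum `p`-weight of an `H`-free igraph on `n` vertices. -/
noncomputable def kex {U : Type*} (p : ℝ) (H : SimpleGraph U) (n : ℕ) : ℝ :=
  sSup {w : ℝ | ∃ C : Igraph (Fin n), ¬ C.Contains H ∧ C.pWeight p = w}

/-- `κ` is the induced `p`-density `κ_p(H)`, the limit of `kex_p(H, n) / (n choose 2)`. -/
def IsInducedDensity {U : Type*} (p : ℝ) (H : SimpleGraph U) (κ : ℝ) : Prop :=
  Filter.Tendsto (fun n : ℕ => kex p H n / (n.choose 2 : ℝ)) Filter.atTop (nhds κ)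

/-- A type on `V`: an igraph in which, moreover, every vertex is coloured red or blue. -/
structure IType (V : Type*) extends Igraph V where
  vertexColour : V → VertexColour

/-- The `p`-weight of an edge colour. -/
def EdgeColour.weight (p : ℝ) : EdgeColour → ℝ
  | .red => p
  | .blue => 1 - p
  | .green => 1

/-- The `p`-weight of a vertex colour. -/
def VertexColour.weight (p : ℝ) : VertexColour → ℝ
  | .red => p
  | .blue => 1 - p

/-- A vertex colour, used as the colour of edges inside a part of a blowup. -/
def VertexColour.toEdgeColour : VertexColour → EdgeColour
  | .red => .red
  | .blue => .blue

namespace IType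

open Classical in
/-- The `m`-fold blowup `m × τ`: edges inside the part of `u` get the colour of `u`, and edges
between the parts of `u` and `v` get the colour of `uv`. -/
noncomputable def blowup {V : Type*} (m : ℕ) (τ : IType V) : Igraph (V × Fin m) where
  colour x y := if x.1 = y.1 then (τ.vertexColour x.1).toEdgeColour else τ.colour x.1 y.1
  symm x y := by
    by_cases h : x.1 = y.1
    · simp [h]
    · simp [h, Ne.symm h, τ.symm x.1 y.1]

/-- `H` is described by `τ` if some blowup of `τ` contains `H`. -/
def Describes {V U : Type*} (τ : IType V) (H : SimpleGraph U) : Prop :=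
  ∃ m : ℕ, (τ.blowup m).Contains H

open Classical in
/-- The matrix `W_p(τ)`. -/
noncomputable def weightMatrix {V : Type*} (p : ℝ) (τ : IType V) : Matrix V V ℝ :=
  Matrix.of fun u v =>
    if u = v then (τ.vertexColour u).weight p else (τ.colour u v).weight p

/-- The `p`-value `λ_p(τ)`, the maximum of `xᵀ W_p(τ) x` over the standard simplex (which is
compact, and nonempty when `V` is). -/
noncomputable def pValue {V : Type*} [Fintype V] (p : ℝ) (τ : IType V) : ℝ :=
  sSup ((fun x : V → ℝ => x ⬝ᵥ (τ.weightMatrix p).mulVec x) '' stdSimplex ℝ V)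

/-- The subtype of `τ` on the vertex set `S`. -/
def restrict {V : Type*} (τ : IType V) (S : Finset V) : IType S where
  colour u v := τ.colour u v
  symm u v := τ.symm u v
  vertexColour u := τ.vertexColour u

/-- `τ` is `p`-core if no proper (nonempty) subtype has the same `p`-value. -/
def IsCore {V : Type*} [Fintype V] (p : ℝ) (τ : IType V) : Prop :=
  ∀ S : Finset V, S.Nonempty → S ≠ Finset.univ → (τ.restrict S).pValue p ≠ τ.pValue p

/-- `τ` has maximum `p`-value among the `p`-core types that do not describe `H`. (Every nonempty
finite type is isomorphic to one on `Fin m` with `m ≥ 1`.) -/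
def IsMaxCoreNotDescribing {V U : Type*} [Fintype V] (p : ℝ) (τ : IType V)
    (H : SimpleGraph U) : Prop :=
  τ.IsCore p ∧ ¬ τ.Describes H ∧
    ∀ (m : ℕ) (σ : IType (Fin m)), 1 ≤ m → σ.IsCore p → ¬ σ.Describes H →
      σ.pValue p ≤ τ.pValue p

/-- `τ` and `σ` are the same type up to a renaming of the vertices. -/
def Isomorphic {V W : Type*} (τ : IType V) (σ : IType W) : Prop :=
  ∃ e : V ≃ W, (∀ u, σ.vertexColour (e u) = τ.vertexColour u) ∧
    ∀ u v, u ≠ v → σ.colour (e u) (e v) = τ.colour u v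

/-- The type `τ(x, y)` with `x` red vertices, `y` blue vertices, and all edges green. -/
def greenType (x y : ℕ) : IType (Fin x ⊕ Fin y) where
  colour _ _ := .green
  symm _ _ := rfl
  vertexColour := Sum.elim (fun _ => .red) (fun _ => .blue)

end IType

/-- The `(a,b)`-eye `I_{a,b}`: the complete graph on `a + b` vertices minus all edges inside a set
of `b` vertices. -/
def eye (a b : ℕ) : SimpleGraph (Fin a ⊕ Fin b) where
  Adj u v := u ≠ v ∧ ¬ (u.isRight = true ∧ v.isRight = true)
  symm := ⟨fun _ _ h => ⟨h.1.symm, fun h' => h.2 ⟨h'.2, h'.1⟩⟩⟩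
  loopless := ⟨fun _ h => h.1 rfl⟩

/-! The density reduces to a question about types. In a large igraph of weight density above `κ +
ε`, many `N`-tuples of vertices are heavy. A positive proportion of all tuples are heavy with one
common colour pattern, so Erdős's box theorem gives `N` large sets with constant colours between
them, and Ramsey's theorem lets each set act as a red or a blue vertex. If the igraph is `H`-free,
this type does not describe `H`, yet its value exceeds `κ` (`Igraph.pWeight_le_of_not_contains`).
Conversely, blowups of a type that does not describe `H` are `H`-free.

For the eye, let `τ` be a core type not describing it, `x` a maximiser and `q` its value. Coreness
makes `x` positive everywhere, so all entries of `W x` equal `q`, and `W u u + W v v < 2 * W u v`. A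
red or green edge between a red and a blue vertex would describe the eye, so mixed edges are blue;
but then the blue vertices alone would attain `q`, so only one vertex colour occurs
(`IsCore.vertexColour_eq`).

All blue: no edge is blue, and `a + 1` vertices would describe the eye; summing the row equations
gives `q ≤ 1 - p / a` (`IsCore.le_of_blue`). All red: no edge is red, and a vertex has at most `b -
2` green neighbours; the row equation at a vertex of largest weight bounds `q` (`IsCore.le_of_red`).
Equality forces a green type on `a` or `b - 1` vertices. -/

theorem EdgeColour.weight_nonneg {p : ℝ} (hp0 : 0 < p) (hp1 : p < 1) (c : EdgeColour) :
    0 ≤ c.weight p := by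
  cases c <;> simp only [EdgeColour.weight] <;> linarith

theorem EdgeColour.weight_le_one {p : ℝ} (hp0 : 0 < p) (hp1 : p < 1) (c : EdgeColour) :
    c.weight p ≤ 1 := by
  cases c <;> simp only [EdgeColour.weight] <;> linarith

/-! ### Types and description as colour-compatible maps -/

namespace IType

open Classical in
/-- The colour between two parts of a blowup, where a part is joined to itself in the colour of
its vertex. -/
noncomputable def partColour {V : Type*} (τ : IType V) (u v : V) : EdgeColour :=
  if u = v then (τ.vertexColour u).toEdgeColour else τ.colour u v

theorem partColour_self {V : Type*} (τ : IType V) (u : V) :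
    τ.partColour u u = (τ.vertexColour u).toEdgeColour := by
  simp [partColour]

theorem partColour_of_ne {V : Type*} (τ : IType V) {u v : V} (h : u ≠ v) :
    τ.partColour u v = τ.colour u v := by
  simp [partColour, h]

theorem weightMatrix_apply {V : Type*} (p : ℝ) (τ : IType V) (u v : V) :
    τ.weightMatrix p u v = (τ.partColour u v).weight p := by
  by_cases h : u = v
  · subst h
    cases hc : τ.vertexColour u <;>
      simp [weightMatrix, partColour_self, hc, VertexColour.toEdgeColour, VertexColour.weight,
        EdgeColour.weight]
  · simp [weightMatrix, partColour, h]

theorem weightMatrix_symm {V : Type*} (p : ℝ) (τ : IType V) (u v : V) :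
    τ.weightMatrix p u v = τ.weightMatrix p v u := by
  by_cases h : u = v
  · rw [h]
  · rw [weightMatrix_apply, weightMatrix_apply, partColour_of_ne _ h,
      partColour_of_ne _ (Ne.symm h), τ.symm]

theorem partColour_restrict {V : Type*} (τ : IType V) (S : Finset V) (u v : S) :
    (τ.restrict S).partColour u v = τ.partColour u v := by
  by_cases h : u = v
  · subst h; simp [partColour_self, restrict]
  · rw [partColour_of_ne _ h, partColour_of_ne _ (fun h' => h (Subtype.ext h'))]
    rfl

/-- A type describes `H` when `H` maps to it compatibly with the colours. -/
theorem describes_iff {V U : Type*} [Finite U] (τ : IType V) (H : SimpleGraph U) :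
    τ.Describes H ↔ ∃ g : U → V,
      (∀ u v, H.Adj u v → τ.partColour (g u) (g v) = .red ∨ τ.partColour (g u) (g v) = .green) ∧
      (∀ u v, Hᶜ.Adj u v →
        τ.partColour (g u) (g v) = .blue ∨ τ.partColour (g u) (g v) = .green) := by
  constructor
  · rintro ⟨m, f, h1, h2⟩
    exact ⟨fun u => (f u).1, fun u v h => (h1 u v h).2, fun u v h => (h2 u v h).2⟩
  · rintro ⟨g, h1, h2⟩
    obtain ⟨m, ⟨e⟩⟩ := Finite.exists_equiv_fin U
    -- Labelling copies by an enumeration of `U` forces injectivity, so `m = |U|` is enough.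
    have hinj : Function.Injective fun u => (g u, e u) :=
      fun u v h => e.injective (Prod.ext_iff.1 h).2
    exact ⟨m, ⟨_, hinj⟩, fun u v h => ⟨hinj.ne h.ne, h1 u v h⟩,
      fun u v h => ⟨hinj.ne h.ne, h2 u v h⟩⟩

theorem Describes.of_restrict {V U : Type*} [Finite U] {τ : IType V} {H : SimpleGraph U}
    {S : Finset V} (h : (τ.restrict S).Describes H) : τ.Describes H := by
  rw [describes_iff] at h ⊢
  obtain ⟨g, h1, h2⟩ := h
  simp only [partColour_restrict] at h1 h2
  exact ⟨fun u => g u, h1, h2⟩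

/-! ### Maximisers of the quadratic form and core types -/

section PValue

variable {V : Type*} [Fintype V] {p : ℝ} {τ : IType V}

theorem exists_pValue [Nonempty V] (p : ℝ) (τ : IType V) :
    ∃ x ∈ stdSimplex ℝ V, x ⬝ᵥ (τ.weightMatrix p).mulVec x = τ.pValue p ∧
      ∀ y ∈ stdSimplex ℝ V, y ⬝ᵥ (τ.weightMatrix p).mulVec y ≤ τ.pValue p := by
  classical
  have hc : Continuous fun x : V → ℝ => x ⬝ᵥ (τ.weightMatrix p).mulVec x := by fun_prop
  have hne : (stdSimplex ℝ V).Nonempty := ⟨_, single_mem_stdSimplex ℝ (Classical.arbitrary V)⟩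
  have hk : IsCompact (stdSimplex ℝ V) := isCompact_stdSimplex ℝ V
  obtain ⟨x, hx, hmax⟩ := hk.exists_isMaxOn hne hc.continuousOn
  have hg : IsGreatest ((fun x : V → ℝ => x ⬝ᵥ (τ.weightMatrix p).mulVec x) '' stdSimplex ℝ V)
      (x ⬝ᵥ (τ.weightMatrix p).mulVec x) := by
    refine ⟨⟨x, hx, rfl⟩, ?_⟩
    rintro _ ⟨y, hy, rfl⟩
    exact hmax hy
  have he : τ.pValue p = x ⬝ᵥ (τ.weightMatrix p).mulVec x := hg.csSup_eq
  exact ⟨x, hx, he.symm, fun y hy => he ▸ hmax hy⟩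

theorem quadForm_le_pValue [Nonempty V] {y : V → ℝ} (hy : y ∈ stdSimplex ℝ V) :
    y ⬝ᵥ (τ.weightMatrix p).mulVec y ≤ τ.pValue p :=
  (exists_pValue p τ).choose_spec.2.2 y hy

theorem quadForm_restrict (S : Finset V) {x : V → ℝ} (hS : ∀ u, u ∉ S → x u = 0) :
    (fun u : S => x u) ⬝ᵥ ((τ.restrict S).weightMatrix p).mulVec (fun u : S => x u) =
      x ⬝ᵥ (τ.weightMatrix p).mulVec x := by
  classical
  simp only [dotProduct, Matrix.mulVec, weightMatrix_apply, partColour_restrict]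
  rw [Finset.sum_coe_sort S (fun u => x u * ∑ v : S, (τ.partColour u v).weight p * x v)]
  rw [← Finset.sum_subset (Finset.subset_univ S) (fun u _ hu => by simp [hS u hu])]
  refine Finset.sum_congr rfl fun u _ => ?_
  rw [Finset.sum_coe_sort S (fun v => (τ.partColour u v).weight p * x v)]
  rw [← Finset.sum_subset (Finset.subset_univ S) (fun u _ hu => by simp [hS u hu])]

theorem restrict_mem_stdSimplex {S : Finset V} {x : V → ℝ} (hx : x ∈ stdSimplex ℝ V)
    (hS : ∀ u, u ∉ S → x u = 0) : (fun u : S => x u) ∈ stdSimplex ℝ S := by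
  refine ⟨fun u => hx.1 u, ?_⟩
  rw [Finset.sum_coe_sort S x, ← hx.2]
  exact Finset.sum_subset (Finset.subset_univ S) (fun u _ hu => hS u hu)

theorem nonempty_of_mem_stdSimplex {x : V → ℝ} (hx : x ∈ stdSimplex ℝ V) : Nonempty V := by
  by_contra h
  rw [not_nonempty_iff] at h
  simpa using hx.2

theorem quadForm_le_pValue_restrict {S : Finset V} {x : V → ℝ} (hx : x ∈ stdSimplex ℝ V)
    (hS : ∀ u, u ∉ S → x u = 0) :
    x ⬝ᵥ (τ.weightMatrix p).mulVec x ≤ (τ.restrict S).pValue p := by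
  have hm := restrict_mem_stdSimplex hx hS
  have := nonempty_of_mem_stdSimplex hm
  rw [← quadForm_restrict S hS]
  exact quadForm_le_pValue hm

theorem pValue_restrict_le {S : Finset V} (hS : S.Nonempty) :
    (τ.restrict S).pValue p ≤ τ.pValue p := by
  classical
  have : Nonempty S := hS.to_subtype
  have : Nonempty V := ⟨hS.choose⟩
  obtain ⟨x, hx, he, -⟩ := exists_pValue p (τ.restrict S)
  let y : V → ℝ := fun u => if h : u ∈ S then x ⟨u, h⟩ else 0
  have hy0 : ∀ u, u ∉ S → y u = 0 := fun u hu => by simp [y, hu]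
  have hyx : (fun u : S => y u) = x := by ext u; simp [y]
  have hy : y ∈ stdSimplex ℝ V := by
    refine ⟨fun u => ?_, ?_⟩
    · by_cases h : u ∈ S
      · simpa [y, h] using hx.1 ⟨u, h⟩
      · simp [y, h]
    · rw [← hx.2, ← hyx, Finset.sum_coe_sort S y]
      exact (Finset.sum_subset (Finset.subset_univ S) (fun u _ hu => hy0 u hu)).symm
  rw [← he]
  have := quadForm_restrict (p := p) (τ := τ) S hy0
  rw [hyx] at this
  rw [this]
  exact quadForm_le_pValue hy

/-- A maximiser of the quadratic form of a core type has full support. -/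
theorem IsCore.pos (hτ : τ.IsCore p) {x : V → ℝ} (hx : x ∈ stdSimplex ℝ V)
    (hmax : τ.pValue p ≤ x ⬝ᵥ (τ.weightMatrix p).mulVec x) (u : V) : 0 < x u := by
  classical
  by_contra hu
  have hu0 : x u = 0 := le_antisymm (not_lt.1 hu) (hx.1 u)
  let S : Finset V := Finset.univ.erase u
  have hS : ∀ v, v ∉ S → x v = 0 := by
    intro v hv
    have : v = u := by simpa [S] using hv
    rw [this, hu0]
  have hne : S.Nonempty := by
    have := nonempty_of_mem_stdSimplex (restrict_mem_stdSimplex hx hS)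
    exact Finset.nonempty_coe_sort.1 this
  refine hτ S hne (fun h => ?_)
    (le_antisymm (pValue_restrict_le hne) (hmax.trans (quadForm_le_pValue_restrict hx hS)))
  have := Finset.mem_univ u
  rw [← h] at this
  simp [S] at this

theorem dotProduct_mulVec_comm (x y : V → ℝ) :
    x ⬝ᵥ (τ.weightMatrix p).mulVec y = y ⬝ᵥ (τ.weightMatrix p).mulVec x := by
  have ht : (τ.weightMatrix p).transpose = τ.weightMatrix p := by
    ext u v; exact τ.weightMatrix_symm p v u
  rw [Matrix.dotProduct_mulVec, ← Matrix.mulVec_transpose, ht, dotProduct_comm]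

/-- Moving weight `t` from `v` to `u`: the linear term gives the first-order condition, the
quadratic term the second-order one. -/
theorem quadForm_shift [DecidableEq V] (x : V → ℝ) (u v : V) (t : ℝ) :
    (x + t • (Pi.single u 1 - Pi.single v 1)) ⬝ᵥ
        (τ.weightMatrix p).mulVec (x + t • (Pi.single u 1 - Pi.single v 1)) =
      x ⬝ᵥ (τ.weightMatrix p).mulVec x +
        2 * t * ((τ.weightMatrix p).mulVec x u - (τ.weightMatrix p).mulVec x v) +
        t ^ 2 * (τ.weightMatrix p u u + τ.weightMatrix p v v - 2 * τ.weightMatrix p u v) := by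
  have h1 := dotProduct_mulVec_comm (p := p) (τ := τ) x (Pi.single u 1 - Pi.single v 1)
  have h2 : (Pi.single u 1 - Pi.single v 1 : V → ℝ) ⬝ᵥ (τ.weightMatrix p).mulVec x =
      (τ.weightMatrix p).mulVec x u - (τ.weightMatrix p).mulVec x v := by
    simp [sub_dotProduct]
  have h3 : (Pi.single u 1 - Pi.single v 1 : V → ℝ) ⬝ᵥ
      (τ.weightMatrix p).mulVec (Pi.single u 1 - Pi.single v 1) =
      τ.weightMatrix p u u + τ.weightMatrix p v v - 2 * τ.weightMatrix p u v := by
    have := τ.weightMatrix_symm p v u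
    simp only [Matrix.mulVec_sub, sub_dotProduct, single_one_dotProduct, Matrix.mulVec_single_one,
      Pi.sub_apply, Matrix.col_apply]
    rw [this]; ring
  rw [Matrix.mulVec_add, Matrix.mulVec_smul, add_dotProduct, dotProduct_add, dotProduct_add,
    smul_dotProduct, smul_dotProduct, dotProduct_smul, dotProduct_smul, h1, h2, h3]
  simp only [smul_eq_mul]
  ring

theorem shift_mem_stdSimplex [DecidableEq V] {x : V → ℝ} (hx : x ∈ stdSimplex ℝ V) {u v : V}
    (huv : u ≠ v) {t : ℝ} (ht : 0 ≤ t) (htv : t ≤ x v) :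
    x + t • (Pi.single u 1 - Pi.single v 1) ∈ stdSimplex ℝ V := by
  refine ⟨fun w => ?_, ?_⟩
  · have := hx.1 w
    by_cases hu : w = u
    · subst hu; simp [huv]; linarith
    · by_cases hv : w = v
      · subst hv; simp [hu]; linarith
      · simp [hu, hv, this]
  · simp [Finset.sum_add_distrib, hx.2, ← Finset.mul_sum]

theorem mulVec_le_of_isMax [Nonempty V] {x : V → ℝ} (hx : x ∈ stdSimplex ℝ V)
    (hmax : x ⬝ᵥ (τ.weightMatrix p).mulVec x = τ.pValue p) {v : V} (hv : 0 < x v) (u : V) :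
    (τ.weightMatrix p).mulVec x u ≤ (τ.weightMatrix p).mulVec x v := by
  classical
  by_contra! hlt
  have huv : u ≠ v := by rintro rfl; exact lt_irrefl _ hlt
  set d := (τ.weightMatrix p).mulVec x u - (τ.weightMatrix p).mulVec x v with hd
  set D := τ.weightMatrix p u u + τ.weightMatrix p v v - 2 * τ.weightMatrix p u v with hD
  have hd0 : 0 < d := sub_pos.2 hlt
  have hD1 : 0 < |D| + 1 := by positivity
  -- The bound `x v` keeps the shifted point in the simplex; the other makes the gain `2 * t * d`
  -- outweigh `t ^ 2 * D`.
  set t := min (x v) (d / (|D| + 1)) with ht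
  have ht0 : 0 < t := lt_min hv (by positivity)
  have h := quadForm_le_pValue (τ := τ) (p := p)
    (shift_mem_stdSimplex hx huv ht0.le (min_le_left _ _))
  rw [quadForm_shift, hmax, ← hd, ← hD] at h
  have h1 : t * (|D| + 1) ≤ d := (le_div_iff₀ hD1).1 (min_le_right _ _)
  have h2 : -|D| ≤ D := neg_abs_le D
  have h3 : 0 ≤ |D| := abs_nonneg D
  have h4 : 0 < 2 * d + t * D := by nlinarith
  nlinarith

/-- The first-order condition at a maximiser of a core type. -/
theorem IsCore.mulVec_eq [Nonempty V] (hτ : τ.IsCore p) {x : V → ℝ} (hx : x ∈ stdSimplex ℝ V)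
    (hmax : x ⬝ᵥ (τ.weightMatrix p).mulVec x = τ.pValue p) (u : V) :
    (τ.weightMatrix p).mulVec x u = τ.pValue p := by
  have h : ∀ v, (τ.weightMatrix p).mulVec x v = (τ.weightMatrix p).mulVec x u := fun v =>
    le_antisymm (mulVec_le_of_isMax hx hmax (hτ.pos hx hmax.ge u) v)
      (mulVec_le_of_isMax hx hmax (hτ.pos hx hmax.ge v) u)
  rw [← hmax, dotProduct]
  simp only [h, ← Finset.sum_mul, hx.2, one_mul]

/-- The second-order condition for a core type. -/
theorem IsCore.lt_weightMatrix [Nonempty V] (hτ : τ.IsCore p) {u v : V} (huv : u ≠ v) :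
    τ.weightMatrix p u u + τ.weightMatrix p v v < 2 * τ.weightMatrix p u v := by
  classical
  obtain ⟨x, hx, hmax, -⟩ := exists_pValue p τ
  by_contra! hle
  -- Move all the weight of `v` to `u`. The linear term vanishes and the quadratic one is
  -- nonnegative, so the result is a maximiser that is zero at `v`.
  have h := quadForm_shift (p := p) (τ := τ) x u v (x v)
  rw [hτ.mulVec_eq hx hmax, hτ.mulVec_eq hx hmax] at h
  have := hτ.pos (shift_mem_stdSimplex hx huv (hx.1 v) le_rfl) (by rw [h, hmax]; nlinarith [sq_nonneg (x v)]) v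
  simp [huv.symm] at this

end PValue

end IType

/-! ### Core types that do not describe an eye -/

namespace IType

/-- All edges of the type are green and all its vertices have colour `c`. -/
def IsGreen {V : Type*} (τ : IType V) (c : VertexColour) : Prop :=
  (∀ u, τ.vertexColour u = c) ∧ ∀ u v, u ≠ v → τ.colour u v = .green

theorem IsGreen.isomorphic_left {V : Type*} [Fintype V] {τ : IType V} {k : ℕ}
    (h : τ.IsGreen .red) (hk : Fintype.card V = k) : τ.Isomorphic (greenType k 0) := by
  let e : V ≃ Fin k ⊕ Fin 0 := Fintype.equivOfCardEq (by simp [hk])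
  refine ⟨e, fun u => ?_, fun u v huv => (h.2 u v huv).symm⟩
  rw [h.1]
  rcases e u with i | i
  · rfl
  · exact i.elim0

theorem IsGreen.isomorphic_right {V : Type*} [Fintype V] {τ : IType V} {k : ℕ}
    (h : τ.IsGreen .blue) (hk : Fintype.card V = k) : τ.Isomorphic (greenType 0 k) := by
  let e : V ≃ Fin 0 ⊕ Fin k := Fintype.equivOfCardEq (by simp [hk])
  refine ⟨e, fun u => ?_, fun u v huv => (h.2 u v huv).symm⟩
  rw [h.1]
  rcases e u with i | i
  · exact i.elim0
  · rfl

theorem weightMatrix_self {V : Type*} (p : ℝ) (τ : IType V) (u : V) :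
    τ.weightMatrix p u u = (τ.vertexColour u).weight p := by
  simp [weightMatrix]

theorem weightMatrix_of_ne {V : Type*} (p : ℝ) (τ : IType V) {u v : V} (h : u ≠ v) :
    τ.weightMatrix p u v = (τ.colour u v).weight p := by
  simp [weightMatrix, h]

/-- The matrix is the all-ones matrix minus `1 - c.weight p` times the identity, so only the sum of
squares matters; Cauchy–Schwarz then makes the uniform vector optimal. -/
theorem IsGreen.quadForm {V : Type*} [Fintype V] {τ : IType V} {c : VertexColour}
    (h : τ.IsGreen c) {p : ℝ} {x : V → ℝ} (hx : ∑ u, x u = 1) :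
    x ⬝ᵥ (τ.weightMatrix p).mulVec x = 1 - (1 - c.weight p) * ∑ u, x u ^ 2 := by
  classical
  have hrow : ∀ u, (τ.weightMatrix p).mulVec x u = 1 - (1 - c.weight p) * x u := by
    intro u
    have hW : ∀ v, τ.weightMatrix p u v * x v =
        x v - if v = u then (1 - c.weight p) * x u else 0 := by
      intro v
      by_cases huv : v = u
      · subst huv; simp [weightMatrix_self, h.1]; ring
      · rw [weightMatrix_of_ne _ _ (Ne.symm huv), h.2 _ _ (Ne.symm huv)]
        simp [huv, EdgeColour.weight]
    simp [Matrix.mulVec, dotProduct, hW, Finset.sum_sub_distrib, hx]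
  simp only [dotProduct, hrow, mul_sub, mul_one, Finset.sum_sub_distrib, hx, Finset.mul_sum]
  congr 1
  exact Finset.sum_congr rfl fun u _ => by ring

theorem IsGreen.pValue_eq {V : Type*} [Fintype V] [Nonempty V] {τ : IType V} {c : VertexColour}
    (h : τ.IsGreen c) {p : ℝ} (hc : c.weight p ≤ 1) :
    τ.pValue p = 1 - (1 - c.weight p) / Fintype.card V := by
  have hk : (0 : ℝ) < Fintype.card V := by exact_mod_cast Fintype.card_pos
  refine le_antisymm ?_ ?_
  · obtain ⟨x, hx, he, -⟩ := exists_pValue p τ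
    rw [← he, h.quadForm hx.2]
    have hcs := sq_sum_le_card_mul_sum_sq (s := Finset.univ) (f := x)
    rw [hx.2, Finset.card_univ, one_pow] at hcs
    have : 1 / (Fintype.card V : ℝ) ≤ ∑ u, x u ^ 2 := by rwa [div_le_iff₀' hk]
    rw [div_eq_mul_one_div]
    have := mul_le_mul_of_nonneg_left this (sub_nonneg.2 hc)
    linarith
  · have hx : (fun _ : V => 1 / (Fintype.card V : ℝ)) ∈ stdSimplex ℝ V :=
      ⟨fun _ => by positivity, by simp⟩
    refine le_trans (le_of_eq ?_) (quadForm_le_pValue (τ := τ) (p := p) hx)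
    rw [h.quadForm hx.2]
    simp
    field_simp

theorem IsGreen.restrict {V : Type*} {τ : IType V} {c : VertexColour} (h : τ.IsGreen c)
    (S : Finset V) : (τ.restrict S).IsGreen c :=
  ⟨fun u => h.1 u, fun u v huv => h.2 u v fun h' => huv (Subtype.ext h')⟩

theorem IsGreen.isCore {V : Type*} [Fintype V] {τ : IType V} {c : VertexColour}
    (h : τ.IsGreen c) {p : ℝ} (hc : c.weight p < 1) : τ.IsCore p := by
  intro S hS hne
  have : Nonempty S := hS.to_subtype
  have : Nonempty V := ⟨hS.choose⟩
  have hlt : S.card < Fintype.card V := (Finset.card_lt_iff_ne_univ S).2 hne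
  rw [(h.restrict S).pValue_eq hc.le, h.pValue_eq hc.le, Fintype.card_coe]
  have h0 : (0 : ℝ) < S.card := by exact_mod_cast hS.card_pos
  have h1 : (S.card : ℝ) < Fintype.card V := by exact_mod_cast hlt
  have := div_lt_div_of_pos_left (sub_pos.2 hc) h0 h1
  exact ne_of_lt (by linarith)

/-- The type on `Fin k` with all edges green and all vertices of colour `c`. -/
def green (k : ℕ) (c : VertexColour) : IType (Fin k) where
  colour _ _ := .green
  symm _ _ := rfl
  vertexColour _ := c

theorem isGreen_green (k : ℕ) (c : VertexColour) : (green k c).IsGreen c :=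
  ⟨fun _ => rfl, fun _ _ _ => rfl⟩

/-- The clique together with one independent vertex is a clique on `a + 1` vertices; two of them
share a part, whose inner edges are blue. -/
theorem IsGreen.not_describes_eye_of_blue {V : Type*} [Fintype V] {τ : IType V}
    (h : τ.IsGreen .blue) {a b : ℕ} (hV : Fintype.card V ≤ a) (hb : 0 < b) :
    ¬ τ.Describes (eye a b) := by
  rw [describes_iff]
  rintro ⟨g, h1, -⟩
  let j : Fin a ⊕ Fin 1 → Fin a ⊕ Fin b := Sum.map id fun _ => ⟨0, hb⟩
  obtain ⟨x, y, hxy, hg⟩ := Fintype.exists_ne_map_eq_of_card_lt (fun x => g (j x))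
    (by simp; omega)
  have hadj : (eye a b).Adj (j x) (j y) := by
    rcases x with x | x <;> rcases y with y | y
    · exact ⟨by simpa [j] using hxy, by simp [j]⟩
    · exact ⟨by simp [j], by simp [j]⟩
    · exact ⟨by simp [j], by simp [j]⟩
    · exact absurd (by rw [Subsingleton.elim x y]) hxy
  have := h1 _ _ hadj
  rw [hg, partColour_self, h.1] at this
  simp [VertexColour.toEdgeColour] at this

theorem eye_compl_adj {a b : ℕ} {u v : Fin a ⊕ Fin b} :
    (eye a b)ᶜ.Adj u v ↔ ∃ i j, i ≠ j ∧ u = .inr i ∧ v = .inr j := by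
  rcases u with u | u <;> rcases v with v | v <;> simp [eye]

theorem IsGreen.not_describes_eye_of_red {V : Type*} [Fintype V] {τ : IType V}
    (h : τ.IsGreen .red) {a b : ℕ} (hV : Fintype.card V < b) :
    ¬ τ.Describes (eye a b) := by
  rw [describes_iff]
  rintro ⟨g, -, h2⟩
  obtain ⟨x, y, hxy, hg⟩ := Fintype.exists_ne_map_eq_of_card_lt (fun x : Fin b => g (.inr x))
    (by simpa using hV)
  have := h2 _ _ (eye_compl_adj.2 ⟨x, y, hxy, rfl, rfl⟩)
  rw [hg, partColour_self, h.1] at this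
  simp [VertexColour.toEdgeColour] at this

/-- A type that does not describe an eye has only blue edges between its blue and its red
vertices. -/
theorem colour_eq_blue_of_not_describes {V : Type*} {τ : IType V} {a b : ℕ}
    (h : ¬ τ.Describes (eye a b)) {u v : V} (hu : τ.vertexColour u = .blue)
    (hv : τ.vertexColour v = .red) : τ.colour u v = .blue := by
  by_contra hne
  have huv : u ≠ v := by rintro rfl; simp [hu] at hv
  have hc : τ.colour u v = .red ∨ τ.colour u v = .green := by
    cases hc : τ.colour u v <;> simp_all
  -- The clique goes into the part of the red `v`, the independent set into the part of the blue
  -- `u`.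
  refine h ((describes_iff _ _).2 ⟨Sum.elim (fun _ => v) (fun _ => u), ?_, ?_⟩)
  · rintro (i | i) (j | j) hij
    · simp [partColour_self, hv, VertexColour.toEdgeColour]
    · simpa [partColour_of_ne _ huv.symm, τ.symm v u] using hc
    · simpa [partColour_of_ne _ huv] using hc
    · exact absurd ⟨rfl, rfl⟩ hij.2
  · intro x y hxy
    obtain ⟨i, j, -, rfl, rfl⟩ := eye_compl_adj.1 hxy
    simp [partColour_self, hu, VertexColour.toEdgeColour]

/-- A core type whose edges between blue and red vertices are all blue has just one vertex
colour. -/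
theorem IsCore.vertexColour_eq {V : Type*} [Fintype V] [Nonempty V] {τ : IType V} {p : ℝ}
    (hτ : τ.IsCore p)
    (h : ∀ u v, τ.vertexColour u = .blue → τ.vertexColour v = .red → τ.colour u v = .blue) :
    (∀ u, τ.vertexColour u = .red) ∨ ∀ u, τ.vertexColour u = .blue := by
  classical
  by_contra! hcon
  obtain ⟨⟨u₀, hu₀⟩, v₀, hv₀⟩ := hcon
  have hu₀ : τ.vertexColour u₀ = .blue := by cases hc : τ.vertexColour u₀ <;> simp_all
  obtain ⟨x, hx, hmax, -⟩ := exists_pValue p τ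
  have hpos := hτ.pos hx hmax.ge
  set q := τ.pValue p with hq
  have hq1 : 1 - p ≤ q := by
    have := quadForm_le_pValue (τ := τ) (p := p) (single_mem_stdSimplex ℝ u₀)
    simpa [weightMatrix_self, hu₀, VertexColour.weight] using this
  set x' : V → ℝ := fun u => if τ.vertexColour u = .blue then x u else 0 with hx'
  set β := ∑ u, x' u with hβ
  have hx'0 : ∀ u, 0 ≤ x' u := fun u => by
    simp only [hx']; split_ifs
    exacts [(hpos u).le, le_rfl]
  have hβ0 : 0 < β := Finset.sum_pos' (fun u _ => hx'0 u)
    ⟨u₀, Finset.mem_univ _, by simp [hx', hu₀, hpos]⟩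
  have hβ1 : β ≤ 1 := by
    rw [← hx.2]
    refine Finset.sum_le_sum fun u _ => ?_
    simp only [hx']; split_ifs
    exacts [le_rfl, (hpos u).le]
  -- The red vertices have total weight `1 - β` and reach a blue vertex only by blue edges, so they
  -- account for `(1 - p) * (1 - β)` of the row sum `q`.
  have hrow : ∀ u, τ.vertexColour u = .blue →
      (τ.weightMatrix p).mulVec x' u = q - (1 - p) * (1 - β) := by
    intro u hu
    have hβ' : 1 - β = ∑ v, (x v - x' v) := by rw [Finset.sum_sub_distrib, hx.2]
    rw [hq, ← hτ.mulVec_eq hx hmax u, hβ', Finset.mul_sum]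
    simp only [Matrix.mulVec, dotProduct]
    rw [← Finset.sum_sub_distrib]
    refine Finset.sum_congr rfl fun v _ => ?_
    cases hv : τ.vertexColour v
    · have huv : u ≠ v := by rintro rfl; simp [hu] at hv
      simp [hx', hv, weightMatrix_of_ne _ _ huv, h u v hu hv, EdgeColour.weight]
    · simp [hx', hv]
  have hQ : x' ⬝ᵥ (τ.weightMatrix p).mulVec x' = β * (q - (1 - p) * (1 - β)) := by
    rw [hβ, Finset.sum_mul, dotProduct]
    refine Finset.sum_congr rfl fun u _ => ?_
    by_cases hu : τ.vertexColour u = .blue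
    · rw [hrow u hu]
    · simp [hx', hu]
  have hy : β⁻¹ • x' ∈ stdSimplex ℝ V := by
    refine ⟨fun u => mul_nonneg (inv_nonneg.2 hβ0.le) (hx'0 u), ?_⟩
    simp only [Pi.smul_apply, smul_eq_mul, ← Finset.mul_sum]
    exact inv_mul_cancel₀ hβ0.ne'
  -- The rescaled blue part has value `(q - (1 - p) * (1 - β)) / β`, which is at least `q` because
  -- `q ≥ 1 - p`. It is thus a maximiser vanishing at the red vertex `v₀`.
  have := hτ.pos hy (by
    rw [Matrix.mulVec_smul, smul_dotProduct, dotProduct_smul, hQ]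
    simp only [smul_eq_mul]
    rw [inv_mul_cancel_left₀ hβ0.ne', ← hq, inv_mul_eq_div, le_div_iff₀ hβ0]
    nlinarith) v₀
  simp [hx', hv₀] at this

/-- The row equation in deficiency form: green edges drop out and the remaining terms are
nonnegative for `0 < p < 1`. -/
theorem IsCore.sum_one_sub_weightMatrix_mul {V : Type*} [Fintype V] [Nonempty V] {τ : IType V}
    {p : ℝ} (hτ : τ.IsCore p) {x : V → ℝ} (hx : x ∈ stdSimplex ℝ V)
    (hmax : x ⬝ᵥ (τ.weightMatrix p).mulVec x = τ.pValue p) (u : V) :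
    ∑ v, (1 - τ.weightMatrix p u v) * x v = 1 - τ.pValue p := by
  rw [← hτ.mulVec_eq hx hmax u]
  simp only [sub_mul, one_mul, Finset.sum_sub_distrib, hx.2]
  rfl

theorem IsCore.le_of_blue {V : Type*} [Fintype V] [Nonempty V] {τ : IType V} {p : ℝ}
    (hp0 : 0 < p) (hp1 : p < 1) (hτ : τ.IsCore p) {a b : ℕ} (ha : 0 < a)
    (hd : ¬ τ.Describes (eye a b)) (hblue : ∀ u, τ.vertexColour u = .blue) :
    τ.pValue p ≤ 1 - p / a ∧ (τ.pValue p = 1 - p / a →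
      τ.IsGreen .blue ∧ Fintype.card V = a) := by
  classical
  have hcol : ∀ u v, u ≠ v → τ.colour u v = .red ∨ τ.colour u v = .green := by
    intro u v huv
    have := hτ.lt_weightMatrix huv
    rw [weightMatrix_self, weightMatrix_self, hblue, hblue, weightMatrix_of_ne _ _ huv] at this
    cases hc : τ.colour u v
    · simp
    · rw [hc] at this; simp only [VertexColour.weight, EdgeColour.weight] at this; linarith
    · simp
  have hcard : Fintype.card V ≤ a := by
    by_contra! hlt
    obtain ⟨f⟩ : Nonempty (Fin a ⊕ Fin 1 ↪ V) :=
      Function.Embedding.nonempty_of_card_le (by simp; omega)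
    -- With `a + 1` vertices available, the clique takes `a` of them and the whole independent set
    -- goes into the last blue part.
    refine hd ((describes_iff _ _).2 ⟨fun x => f (Sum.map id (fun _ => 0) x), ?_, ?_⟩)
    · intro x y hxy
      have hne : f (Sum.map id (fun _ => 0) x) ≠ f (Sum.map id (fun _ => 0) y) := by
        refine f.injective.ne ?_
        rcases x with x | x <;> rcases y with y | y
        · simpa using hxy.1
        · simp
        · simp
        · exact absurd ⟨rfl, rfl⟩ hxy.2
      rw [partColour_of_ne _ hne]
      exact hcol _ _ hne
    · intro x y hxy
      obtain ⟨i, j, -, rfl, rfl⟩ := eye_compl_adj.1 hxy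
      simp [partColour_self, hblue, VertexColour.toEdgeColour]
  obtain ⟨x, hx, hmax, -⟩ := exists_pValue p τ
  have hpos := hτ.pos hx hmax.ge
  set q := τ.pValue p with hq
  have hle1 : ∀ u v, τ.weightMatrix p u v ≤ 1 := fun u v => by
    rw [weightMatrix_apply]; exact EdgeColour.weight_le_one hp0 hp1 _
  have hrow : ∀ u, p * x u + ∑ v ∈ Finset.univ.erase u, (1 - τ.weightMatrix p u v) * x v =
      1 - q := by
    intro u
    rw [hq, ← hτ.sum_one_sub_weightMatrix_mul hx hmax u,
      ← Finset.add_sum_erase _ _ (Finset.mem_univ u), weightMatrix_self, hblue]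
    simp only [VertexColour.weight, sub_sub_cancel]
  have hnn : ∀ u, ∀ v ∈ Finset.univ.erase u, 0 ≤ (1 - τ.weightMatrix p u v) * x v :=
    fun u v _ => mul_nonneg (sub_nonneg.2 (hle1 u v)) (hpos v).le
  have hxle : ∀ u, p * x u ≤ 1 - q := fun u => by
    have := Finset.sum_nonneg (hnn u)
    linarith [hrow u]
  have ha' : (0 : ℝ) < a := by exact_mod_cast ha
  have hcard' : (Fintype.card V : ℝ) ≤ a := by exact_mod_cast hcard
  have hsum : p ≤ Fintype.card V * (1 - q) := by
    have := Finset.sum_le_sum fun u (_ : u ∈ Finset.univ) => hxle u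
    rw [← Finset.mul_sum, hx.2, Finset.sum_const, Finset.card_univ, nsmul_eq_mul] at this
    linarith
  have h1q : 0 ≤ 1 - q := by
    have := hxle (Classical.arbitrary V)
    have := mul_pos hp0 (hpos (Classical.arbitrary V))
    linarith
  have hpa : p / a ≤ 1 - q := by
    rw [div_le_iff₀' ha']
    exact hsum.trans (mul_le_mul_of_nonneg_right hcard' h1q)
  refine ⟨by linarith, fun heq => ?_⟩
  have hqa : 1 - q = p / a := by linarith
  have hk : Fintype.card V = a := by
    refine le_antisymm hcard ?_
    rw [hqa, mul_div_assoc', le_div_iff₀ ha', mul_comm] at hsum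
    exact_mod_cast le_of_mul_le_mul_right hsum hp0
  have heqall : ∀ u, p * x u = 1 - q := by
    have : ∑ u, p * x u = ∑ _u : V, (1 - q) := by
      rw [← Finset.mul_sum, hx.2, hqa]
      simp [hk]
      field_simp
    intro u
    exact (Finset.sum_eq_sum_iff_of_le fun u _ => hxle u).1 this u (Finset.mem_univ u)
  refine ⟨⟨hblue, fun u v huv => ?_⟩, hk⟩
  have h0 : ∑ v ∈ Finset.univ.erase u, (1 - τ.weightMatrix p u v) * x v = 0 := by
    linarith [hrow u, heqall u]
  have := (Finset.sum_eq_zero_iff_of_nonneg (hnn u)).1 h0 v (by simp [huv.symm])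
  rw [weightMatrix_of_ne _ _ huv] at this
  rcases hcol u v huv with hc | hc
  · rw [hc] at this
    simp only [EdgeColour.weight] at this
    rcases mul_eq_zero.1 this with h' | h'
    · linarith
    · exact absurd h' (hpos v).ne'
  · exact hc

theorem IsCore.le_of_red {V : Type*} [Fintype V] [Nonempty V] {τ : IType V} {p : ℝ}
    (hp0 : 0 < p) (hp1 : p < 1) (hτ : τ.IsCore p) {a b : ℕ} (hb : 2 ≤ b)
    (hd : ¬ τ.Describes (eye a b)) (hred : ∀ u, τ.vertexColour u = .red) :
    τ.pValue p ≤ 1 - p ∨ τ.pValue p < 1 - (1 - p) / (b - 1) ∨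
      (τ.pValue p = 1 - (1 - p) / (b - 1) ∧ τ.IsGreen .red ∧ Fintype.card V = b - 1) := by
  classical
  have hcol : ∀ u v, u ≠ v → τ.colour u v = .blue ∨ τ.colour u v = .green := by
    intro u v huv
    have := hτ.lt_weightMatrix huv
    rw [weightMatrix_self, weightMatrix_self, hred, hred, weightMatrix_of_ne _ _ huv] at this
    cases hc : τ.colour u v
    · rw [hc] at this; simp only [VertexColour.weight, EdgeColour.weight] at this; linarith
    · simp
    · simp
  let N : V → Finset V := fun u => {v | v ≠ u ∧ τ.colour u v = .green}
  let B : V → Finset V := fun u => {v | v ≠ u ∧ τ.colour u v = .blue}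
  -- Otherwise `u` and its green neighbours supply `b` parts for the independent set, while the
  -- clique goes into the part of the red `u`.
  have hN : ∀ u, (N u).card + 2 ≤ b := by
    intro u
    by_contra! hlt
    have hins : (insert u (N u)).card = (N u).card + 1 :=
      Finset.card_insert_of_notMem (by simp [N])
    obtain ⟨f⟩ : Nonempty (Fin b ↪ (insert u (N u) : Finset V)) :=
      Function.Embedding.nonempty_of_card_le (by rw [Fintype.card_fin, Fintype.card_coe]; omega)
    have hf : ∀ i, τ.partColour u (f i) = .red ∨ τ.partColour u (f i) = .green := by
      intro i
      have := (f i).2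
      rw [Finset.mem_insert] at this
      rcases this with h | h
      · rw [h, partColour_self, hred]; simp [VertexColour.toEdgeColour]
      · simp only [N, Finset.mem_filter, Finset.mem_univ, true_and] at h
        rw [partColour_of_ne _ h.1.symm, h.2]; simp
    refine hd ((describes_iff _ _).2 ⟨Sum.elim (fun _ => u) (fun i => f i), ?_, ?_⟩)
    · rintro (i | i) (j | j) hij
      · simp [partColour_self, hred, VertexColour.toEdgeColour]
      · exact hf j
      · have := hf i
        by_cases h : u = f i
        · rw [← h] at this; simpa [← h] using this
        · rw [partColour_of_ne _ h, τ.symm] at this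
          simpa [partColour_of_ne _ (Ne.symm h)] using this
      · exact absurd ⟨rfl, rfl⟩ hij.2
    · intro x y hxy
      obtain ⟨i, j, hij, rfl, rfl⟩ := eye_compl_adj.1 hxy
      have hne : (f i : V) ≠ f j := fun h => hij (f.injective (Subtype.ext h))
      simpa [partColour_of_ne _ hne] using hcol _ _ hne
  obtain ⟨x, hx, hmax, -⟩ := exists_pValue p τ
  have hpos := hτ.pos hx hmax.ge
  set q := τ.pValue p with hq
  have hsplit : ∀ (u : V) (f : V → ℝ), ∑ v, f v = f u + (∑ v ∈ N u, f v + ∑ v ∈ B u, f v) := by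
    intro u f
    have hdisj : Disjoint (N u) (B u) := by
      rw [Finset.disjoint_left]
      intro v hv hv'
      simp only [N, B, Finset.mem_filter, Finset.mem_univ, true_and] at hv hv'
      rw [hv.2] at hv'; simp at hv'
    rw [← Finset.sum_union hdisj, ← Finset.add_sum_erase _ _ (Finset.mem_univ u)]
    congr 1
    refine Finset.sum_congr ?_ fun _ _ => rfl
    ext v
    simp only [N, B, Finset.mem_erase, Finset.mem_union, Finset.mem_filter, Finset.mem_univ,
      true_and, and_true]
    constructor
    · intro h
      rcases hcol u v h.symm with hc | hc <;> simp [h, hc]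
    · rintro (h | h) <;> exact h.1
  have hrow : ∀ u, 1 - q = (1 - p) * x u + p * ∑ v ∈ B u, x v := by
    intro u
    rw [hq, ← hτ.sum_one_sub_weightMatrix_mul hx hmax u, hsplit u]
    have h1 : ∑ v ∈ N u, ((1 - τ.weightMatrix p u v) * x v) = 0 := by
      refine Finset.sum_eq_zero fun v hv => ?_
      simp only [N, Finset.mem_filter, Finset.mem_univ, true_and] at hv
      rw [weightMatrix_of_ne _ _ hv.1.symm, hv.2]
      simp [EdgeColour.weight]
    have h2 : ∑ v ∈ B u, ((1 - τ.weightMatrix p u v) * x v) = p * ∑ v ∈ B u, x v := by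
      rw [Finset.mul_sum]
      refine Finset.sum_congr rfl fun v hv => ?_
      simp only [B, Finset.mem_filter, Finset.mem_univ, true_and] at hv
      rw [weightMatrix_of_ne _ _ hv.1.symm, hv.2]
      simp only [EdgeColour.weight, sub_sub_cancel]
    rw [h1, h2, weightMatrix_self, hred]
    simp only [VertexColour.weight]; ring
  have hBnn : ∀ u, 0 ≤ ∑ v ∈ B u, x v := fun u => Finset.sum_nonneg fun v _ => (hpos v).le
  obtain ⟨u, -, hu⟩ := Finset.exists_max_image Finset.univ x ⟨Classical.arbitrary V, by simp⟩
  have hNle : ∀ w, ∑ v ∈ N w, x v ≤ (N w).card * x u := fun w => by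
    have := Finset.sum_le_sum fun v (_ : v ∈ N w) => hu v (Finset.mem_univ v)
    simpa using this
  have hb1 : (0 : ℝ) < (b : ℝ) - 1 := by
    have : (2 : ℝ) ≤ b := by exact_mod_cast hb
    linarith
  have hNb : ∀ w, ((N w).card : ℝ) ≤ (b : ℝ) - 2 := fun w => by
    have : (((N w).card + 2 : ℕ) : ℝ) ≤ b := by exact_mod_cast hN w
    push_cast at this; linarith
  have htot := hsplit u x
  rw [hx.2] at htot
  have hxu := hpos u
  have hNu : ∑ v ∈ N u, x v ≤ ((b : ℝ) - 2) * x u :=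
    (hNle u).trans (mul_le_mul_of_nonneg_right (hNb u) hxu.le)
  have hp1' : 0 < 1 - p := by linarith
  rcases lt_or_ge ((b - 1) * x u) 1 with hM | hM
  -- The blue neighbours of `u` weigh at least `1 - (b - 1) * x u`; substitute this in the row
  -- equation. The sign of `1 - b * p` decides which value of `x u` is extremal: `0` or `1 / (b -
  -- 1)`.
  · have hlow : p + x u * (1 - b * p) ≤ 1 - q := by
      rw [hrow u]
      nlinarith
    rcases le_or_gt (b * p) 1 with hbp | hbp
    · left
      have : 0 ≤ x u * (1 - b * p) := mul_nonneg hxu.le (by linarith)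
      linarith
    · right; left
      have h1 : (1 - p) / ((b : ℝ) - 1) < 1 - q := by
        rw [div_lt_iff₀ hb1]
        have := mul_le_mul_of_nonneg_right hlow hb1.le
        nlinarith
      linarith
  · have hlow : (1 - p) / ((b : ℝ) - 1) ≤ 1 - q := by
      rw [div_le_iff₀ hb1, hrow u]
      have := mul_nonneg (mul_nonneg hp0.le (hBnn u)) hb1.le
      nlinarith
    rcases hlow.lt_or_eq with hlt | heq
    · right; left; linarith
    · right; right
      refine ⟨by linarith, ?_⟩
      -- In the equality case a vertex of largest weight has no blue neighbour. Hence `V` consists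
      -- of `u` and `N u`, all weights are equal, and the same holds at every vertex.
      have hBmax : ∀ w, x w = x u → B w = ∅ ∧ x w * (b - 1) = 1 := by
        intro w hw
        have h1 := hrow w
        rw [hw, ← heq, div_eq_iff hb1.ne'] at h1
        have h0 := mul_nonneg hp0.le (hBnn w)
        have h2 : (1 - p) * (x u * (b - 1)) + (p * ∑ v ∈ B w, x v) * (b - 1) = 1 - p := by
          linear_combination (-1 : ℝ) * h1
        have h3 := mul_nonneg h0 hb1.le
        have h4 : x u * (b - 1) = 1 := by nlinarith
        rw [h4] at h2
        have h5 : ∑ v ∈ B w, x v = 0 := by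
          have : (p * ∑ v ∈ B w, x v) * (b - 1) = 0 := by linarith
          simpa [hb1.ne', hp0.ne'] using this
        refine ⟨?_, hw ▸ h4⟩
        rw [Finset.eq_empty_iff_forall_notMem]
        intro v hv
        have := (Finset.sum_eq_zero_iff_of_nonneg fun v _ => (hpos v).le).1 h5 v hv
        exact (hpos v).ne' this
      have hcard : Fintype.card V ≤ b - 1 := by
        have h1 : ∀ v, v ∈ insert u (N u) := by
          intro v
          by_cases hvu : v = u
          · simp [hvu]
          · rcases hcol u v (Ne.symm hvu) with hc | hc
            · have : v ∈ B u := by simp [B, hvu, hc]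
              simp [(hBmax u rfl).1] at this
            · simp [N, hvu, hc]
        have h2 := Finset.card_le_card (fun v _ => h1 v : Finset.univ ⊆ insert u (N u))
        have h3 := Finset.card_insert_le u (N u)
        have h4 := hN u
        rw [Finset.card_univ] at h2
        omega
      have hcard' : (Fintype.card V : ℝ) ≤ b - 1 := by
        have : ((Fintype.card V + 1 : ℕ) : ℝ) ≤ b := by exact_mod_cast (by omega)
        push_cast at this; linarith
      have hsum : (1 : ℝ) ≤ Fintype.card V * x u := by
        have := Finset.sum_le_sum fun v (hv : v ∈ Finset.univ) => hu v hv
        rw [hx.2] at this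
        simpa using this
      have hu1 := (hBmax u rfl).2
      have hk : (Fintype.card V : ℝ) = b - 1 := by
        refine le_antisymm hcard' ?_
        rw [← hu1, mul_comm] at hsum
        exact le_of_mul_le_mul_right hsum hxu
      have hall : ∀ v, x v = x u := by
        have : ∑ v, x v = ∑ _v : V, x u := by
          rw [hx.2]; simp [hk]; linarith
        intro v
        exact (Finset.sum_eq_sum_iff_of_le fun v hv => hu v hv).1 this v (Finset.mem_univ v)
      refine ⟨⟨hred, fun w v hwv => ?_⟩, ?_⟩
      · rcases hcol w v hwv with hc | hc
        · have : v ∈ B w := by simp [B, hwv.symm, hc]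
          simp [(hBmax w (hall w)).1] at this
        · exact hc
      · have : ((Fintype.card V + 1 : ℕ) : ℝ) = b := by push_cast; linarith
        have : Fintype.card V + 1 = b := by exact_mod_cast this
        omega

/-- The `p`-value of a core type that does not describe the eye `I_{a,b}`, with the cases of
equality. -/
theorem IsCore.pValue_of_not_describes_eye {V : Type*} [Fintype V] [Nonempty V] {τ : IType V}
    {p : ℝ} (hp0 : 0 < p) (hp1 : p < 1) (hτ : τ.IsCore p) {a b : ℕ} (ha : 2 ≤ a) (hb : 2 ≤ b)
    (hd : ¬ τ.Describes (eye a b)) :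
    τ.pValue p < max (1 - p / a) (1 - (1 - p) / (b - 1)) ∨
      (τ.pValue p ≤ max (1 - p / a) (1 - (1 - p) / (b - 1)) ∧
        (τ.Isomorphic (greenType 0 a) ∨ τ.Isomorphic (greenType (b - 1) 0))) := by
  rcases hτ.vertexColour_eq fun u v => colour_eq_blue_of_not_describes hd with hc | hc
  · rcases hτ.le_of_red hp0 hp1 hb hd hc with h | h | ⟨h, hg, hk⟩
    · left
      refine lt_max_of_lt_left (h.trans_lt ?_)
      -- The value `1 - p` is beaten strictly because `a ≥ 2`.
      have : p / a < p := div_lt_self hp0 (by exact_mod_cast ha)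
      linarith
    · exact .inl (lt_max_of_lt_right h)
    · exact .inr ⟨le_max_of_le_right h.le, .inr (hg.isomorphic_left hk)⟩
  · obtain ⟨h1, h2⟩ := hτ.le_of_blue hp0 hp1 (by omega) hd hc
    rcases h1.lt_or_eq with h | h
    · exact .inl (lt_max_of_lt_left h)
    · exact .inr ⟨le_max_of_le_left h1, .inl ((h2 h).1.isomorphic_right (h2 h).2)⟩

/-- A type that is not core has a proper subtype of equal value, which again does not describe the
eye; descend to a core one. -/
theorem pValue_le_of_not_describes_eye {V : Type*} [Fintype V] [Nonempty V] {τ : IType V}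
    {p : ℝ} (hp0 : 0 < p) (hp1 : p < 1) {a b : ℕ} (ha : 2 ≤ a) (hb : 2 ≤ b)
    (hd : ¬ τ.Describes (eye a b)) :
    τ.pValue p ≤ max (1 - p / a) (1 - (1 - p) / (b - 1)) := by
  classical
  induction hn : Fintype.card V using Nat.strong_induction_on generalizing V with
  | _ n ih =>
    by_cases hτ : τ.IsCore p
    · rcases hτ.pValue_of_not_describes_eye hp0 hp1 ha hb hd with h | h
      exacts [h.le, h.1]
    · simp only [IsCore, not_forall, not_not] at hτ
      obtain ⟨S, hS, hne, he⟩ := hτ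
      have : Nonempty S := hS.to_subtype
      rw [← he]
      refine ih _ ?_ (fun h => hd h.of_restrict) rfl
      rw [← hn, Fintype.card_coe]
      exact (Finset.card_lt_iff_ne_univ S).2 hne

theorem IsMaxCoreNotDescribing.isomorphic_greenType {V : Type*} [Fintype V] [Nonempty V]
    {τ : IType V} {p : ℝ} (hp0 : 0 < p) (hp1 : p < 1) {a b : ℕ} (ha : 2 ≤ a) (hb : 2 ≤ b)
    (hτ : τ.IsMaxCoreNotDescribing p (eye a b)) :
    τ.Isomorphic (greenType 0 a) ∨ τ.Isomorphic (greenType (b - 1) 0) := by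
  obtain ⟨hc, hd, hmax⟩ := hτ
  rcases hc.pValue_of_not_describes_eye hp0 hp1 ha hb hd with h | h
  -- Both extremal green types are core and do not describe the eye, so the value of `τ` cannot lie
  -- strictly below the bound.
  · exfalso
    have : NeZero a := ⟨by omega⟩
    have : NeZero (b - 1) := ⟨by omega⟩
    have hblue := isGreen_green a .blue
    have hred := isGreen_green (b - 1) .red
    have h1 := hmax a _ (by omega) (hblue.isCore (p := p) (by simp [VertexColour.weight, hp0]))
      (hblue.not_describes_eye_of_blue (by simp) (by omega))
    have h2 := hmax (b - 1) _ (by omega) (hred.isCore (p := p) (by simp [VertexColour.weight, hp1]))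
      (hred.not_describes_eye_of_red (by simp; omega))
    rw [hblue.pValue_eq (by simp [VertexColour.weight, hp0.le])] at h1
    rw [hred.pValue_eq (by simp [VertexColour.weight, hp1.le])] at h2
    simp only [VertexColour.weight, sub_sub_cancel, Fintype.card_fin] at h1 h2
    rw [Nat.cast_sub (by omega), Nat.cast_one] at h2
    exact absurd (max_le h1 h2) (not_le.2 h)
  · exact h.2

end IType

/-! ### Boxes in dense sets of tuples, and Ramsey's theorem -/

open Classical in
theorem card_mul_card_not_injective_le (ι α : Type*) [DecidableEq ι] [Fintype ι] [Fintype α] :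
    Fintype.card α * (Finset.univ.filter fun s : ι → α => ¬ Function.Injective s).card ≤
      Fintype.card ι ^ 2 * Fintype.card α ^ Fintype.card ι := by
  have key : ∀ i j : ι, i ≠ j →
      Fintype.card α * (Finset.univ.filter fun s : ι → α => s i = s j).card ≤
        Fintype.card α ^ Fintype.card ι := by
    intro i j hij
    rw [← Fintype.card_fun, ← Finset.card_univ (α := α), ← Finset.card_product,
      ← Finset.card_univ (α := ι → α)]
    -- Overwriting entry `i` loses nothing when `s i = s j`, since the old value survives at `j`.
    refine Finset.card_le_card_of_injOn (fun q => Function.update q.2 i q.1)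
      (fun _ _ => Finset.mem_coe.2 (Finset.mem_univ _)) ?_
    rintro ⟨x, s⟩ hs ⟨y, t⟩ ht h
    simp only [Finset.coe_product, Set.mem_prod, Finset.mem_coe, Finset.mem_filter,
      Finset.mem_univ, true_and] at hs ht
    have h' : ∀ k, k ≠ i → s k = t k := fun k hk => by simpa [hk] using congrFun h k
    refine Prod.ext (by simpa using congrFun h i) (funext fun k => ?_)
    by_cases hk : k = i
    · show s k = t k
      rw [hk, hs, ht, h' j hij.symm]
    · exact h' k hk
  calc _ ≤ Fintype.card α * ∑ q : ι × ι, (Finset.univ.filter fun s : ι → α =>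
        q.1 ≠ q.2 ∧ s q.1 = s q.2).card := by
        refine Nat.mul_le_mul_left _ (le_trans (Finset.card_le_card ?_) Finset.card_biUnion_le)
        intro s hs
        simp only [Finset.mem_filter, Finset.mem_univ, true_and, Function.Injective,
          not_forall] at hs
        obtain ⟨i, j, h, hij⟩ := hs
        simp only [Finset.mem_biUnion, Finset.mem_filter, Finset.mem_univ, true_and]
        exact ⟨(i, j), hij, h⟩
    _ = ∑ q : ι × ι, Fintype.card α * (Finset.univ.filter fun s : ι → α =>
        q.1 ≠ q.2 ∧ s q.1 = s q.2).card := Finset.mul_sum _ _ _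
    _ ≤ ∑ _q : ι × ι, Fintype.card α ^ Fintype.card ι := by
        refine Finset.sum_le_sum fun q _ => ?_
        by_cases hq : q.1 = q.2
        · simp [hq]
        · simpa [hq] using key q.1 q.2 hq
    _ = _ := by simp [sq]

/-- A dense set of `N`-tuples contains a large box (Erdős). -/
theorem exists_box_of_dense (N m : ℕ) : ∀ δ : ℝ, 0 < δ → ∃ n₀ : ℕ, ∀ n, n₀ ≤ n →
    ∀ E : Set (Fin N → Fin n), δ * (n : ℝ) ^ N ≤ E.ncard →
      ∃ A : Fin N → (Fin m ↪ Fin n), ∀ j : Fin N → Fin m, (fun i => A i (j i)) ∈ E := by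
  classical
  induction N with
  | zero =>
    intro δ hδ
    refine ⟨0, fun n _ E hE => ⟨fun i => i.elim0, fun j => ?_⟩⟩
    rw [pow_zero, mul_one] at hE
    have hpos : 0 < E.ncard := by exact_mod_cast hδ.trans_le hE
    obtain ⟨e, he⟩ := (Set.ncard_pos E.toFinite).1 hpos
    rwa [Subsingleton.elim (fun i => _) e]
  | succ N ih =>
    intro δ hδ
    obtain ⟨n₁, hn₁⟩ := ih (δ ^ m / 2) (by positivity)
    obtain ⟨n₂, hn₂⟩ := exists_nat_gt ((m : ℝ) ^ 2 / (δ ^ m / 2))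
    refine ⟨max (max n₁ n₂) 1, fun n hn E hE => ?_⟩
    have hn1 : n₁ ≤ n := by omega
    have hn2 : n₂ ≤ n := by omega
    have hn0 : (0 : ℝ) < n := by exact_mod_cast (by omega : 0 < n)
    have hm2 : (m : ℝ) ^ 2 < δ ^ m / 2 * n := by
      rw [div_lt_iff₀' (by positivity)] at hn₂
      exact hn₂.trans_le (mul_le_mul_of_nonneg_left (by exact_mod_cast hn2) (by positivity))
    -- `X y` is the set of heads extending the tail `y` into `E`; `Y s` is the set of tails common
    -- to the `m` heads in `s`.
    let X : (Fin N → Fin n) → Finset (Fin n) := fun y =>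
      Finset.univ.filter fun x => Fin.cons (α := fun _ => Fin n) x y ∈ E
    let Y : (Fin m → Fin n) → Finset (Fin N → Fin n) := fun s =>
      Finset.univ.filter fun y => ∀ i, Fin.cons (α := fun _ => Fin n) (s i) y ∈ E
    have hEX : E.ncard = ∑ y, (X y).card := by
      rw [Set.ncard_eq_toFinset_card' E, ← Finset.card_sigma]
      refine Finset.card_bij' (fun e _ => ⟨Fin.tail e, e 0⟩)
        (fun q _ => Fin.cons (α := fun _ => Fin n) q.2 q.1) ?_ ?_ ?_ ?_
      · intro e he
        simpa [X] using he
      · intro q hq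
        simpa [X] using hq
      · intro e _
        exact Fin.cons_self_tail e
      · intro q _
        simp
    have hXY : ∑ s, (Y s).card = ∑ y, (X y).card ^ m := by
      have h1 : ∀ y, (X y).card ^ m =
          (Finset.univ.filter fun s : Fin m → Fin n => ∀ i, s i ∈ X y).card := by
        intro y
        have : (Finset.univ.filter fun s : Fin m → Fin n => ∀ i, s i ∈ X y) =
            Fintype.piFinset fun _ => X y := by ext s; simp
        rw [this, Fintype.card_piFinset]
        simp
      simp only [h1, Y]
      have := Finset.sum_card_bipartiteAbove_eq_sum_card_bipartiteBelow
        (s := (Finset.univ : Finset (Fin m → Fin n)))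
        (t := (Finset.univ : Finset (Fin N → Fin n)))
        (fun s y => ∀ i, Fin.cons (α := fun _ => Fin n) (s i) y ∈ E)
      simpa [Finset.bipartiteAbove, Finset.bipartiteBelow, X] using this
    have hYle : ∀ s, ((Y s).card : ℝ) ≤ (n : ℝ) ^ N := by
      intro s
      have := Finset.card_le_univ (Y s)
      rw [Fintype.card_fun, Fintype.card_fin, Fintype.card_fin] at this
      exact_mod_cast this
    -- Convexity of the `m`-th power, applied to the average of `|X y|`, which is at least `δ * n`.
    have hlow : δ ^ m * (n : ℝ) ^ m * (n : ℝ) ^ N ≤ ∑ s, ((Y s).card : ℝ) := by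
      have hXY' : ∑ s, ((Y s).card : ℝ) = ∑ y, ((X y).card : ℝ) ^ m := by exact_mod_cast hXY
      rw [hXY']
      have hw : ∑ _y : Fin N → Fin n, ((n : ℝ) ^ N)⁻¹ = 1 := by
        simp [hn0.ne']
      have hj := Real.pow_arith_mean_le_arith_mean_pow Finset.univ
        (fun _ : Fin N → Fin n => ((n : ℝ) ^ N)⁻¹) (fun y => ((X y).card : ℝ))
        (fun _ _ => by positivity) hw (fun _ _ => by positivity) m
      rw [← Finset.mul_sum, ← Finset.mul_sum] at hj
      have hE' : (E.ncard : ℝ) = ∑ y, ((X y).card : ℝ) := by exact_mod_cast hEX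
      rw [← hE'] at hj
      have hd : δ * n ≤ ((n : ℝ) ^ N)⁻¹ * E.ncard := by
        rw [inv_mul_eq_div, le_div_iff₀ (by positivity)]
        rw [pow_succ] at hE
        linarith
      have h2 := (pow_le_pow_left₀ (by positivity) hd m).trans hj
      rw [inv_mul_eq_div, le_div_iff₀ (by positivity), mul_pow] at h2
      exact h2
    have hbad : ∑ s ∈ Finset.univ.filter (fun s : Fin m → Fin n => ¬ Function.Injective s),
        ((Y s).card : ℝ) < δ ^ m / 2 * (n : ℝ) ^ m * (n : ℝ) ^ N := by
      have h1 := Finset.sum_le_card_nsmul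
        (Finset.univ.filter (fun s : Fin m → Fin n => ¬ Function.Injective s))
        (fun s => ((Y s).card : ℝ)) _ (fun s _ => hYle s)
      rw [nsmul_eq_mul] at h1
      refine h1.trans_lt (mul_lt_mul_of_pos_right ?_ (by positivity))
      have h2 := card_mul_card_not_injective_le (Fin m) (Fin n)
      rw [Fintype.card_fin, Fintype.card_fin] at h2
      have h3 : (n : ℝ) * ((Finset.univ.filter
          (fun s : Fin m → Fin n => ¬ Function.Injective s)).card : ℝ) ≤
          (m : ℝ) ^ 2 * (n : ℝ) ^ m := by
        norm_cast
        convert h2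
      have h4 : (m : ℝ) ^ 2 * (n : ℝ) ^ m < δ ^ m / 2 * n * (n : ℝ) ^ m :=
        mul_lt_mul_of_pos_right hm2 (by positivity)
      refine lt_of_mul_lt_mul_left (h3.trans_lt (h4.trans_eq (by ring))) hn0.le
    -- Non-injective `s` carry less than half of the lower bound, so some injective `s` has many
    -- common tails; this is why the density passes from `δ` to `δ ^ m / 2`.
    obtain ⟨s, hs, hsY⟩ : ∃ s : Fin m → Fin n, Function.Injective s ∧
        δ ^ m / 2 * (n : ℝ) ^ N ≤ (Y s).card := by
      by_contra! hcon
      have h1 := Finset.sum_le_card_nsmul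
        (Finset.univ.filter (fun s : Fin m → Fin n => Function.Injective s))
        (fun s => ((Y s).card : ℝ)) (δ ^ m / 2 * (n : ℝ) ^ N)
        (fun s hs => (hcon s (by simpa using hs)).le)
      have h2 : ((Finset.univ.filter
          (fun s : Fin m → Fin n => Function.Injective s)).card : ℝ) ≤ (n : ℝ) ^ m := by
        have := Finset.card_le_univ (Finset.univ.filter
          (fun s : Fin m → Fin n => Function.Injective s))
        rw [Fintype.card_fun, Fintype.card_fin, Fintype.card_fin] at this
        exact_mod_cast this
      rw [nsmul_eq_mul] at h1
      have h3 := mul_le_mul_of_nonneg_right h2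
        (by positivity : 0 ≤ δ ^ m / 2 * (n : ℝ) ^ N)
      have h4 := Finset.sum_filter_add_sum_filter_not Finset.univ
        (fun s : Fin m → Fin n => Function.Injective s) (fun s => ((Y s).card : ℝ))
      linarith
    obtain ⟨A, hA⟩ := hn₁ n hn1 (Y s : Set (Fin N → Fin n))
      (by rwa [Set.ncard_coe_finset])
    refine ⟨Fin.cons ⟨s, hs⟩ A, fun j => ?_⟩
    have h := hA (Fin.tail j)
    simp only [Y, Finset.coe_filter, Finset.mem_univ, true_and, Set.mem_ofPred_eq] at h
    convert h (j 0) using 1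
    ext i
    refine Fin.cases ?_ (fun i => ?_) i <;> simp [Fin.tail]

/-- Ramsey's theorem for graphs. -/
theorem exists_clique_or_indep (s t : ℕ) : ∃ R : ℕ, ∀ {α : Type} (r : α → α → Prop),
    (∀ x y, r x y → r y x) → ∀ S : Finset α, R ≤ S.card →
      (∃ T ⊆ S, T.card = s ∧ ∀ x ∈ T, ∀ y ∈ T, x ≠ y → r x y) ∨
      (∃ T ⊆ S, T.card = t ∧ ∀ x ∈ T, ∀ y ∈ T, x ≠ y → ¬ r x y) := by
  classical
  induction hn : s + t generalizing s t with
  | zero =>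
    refine ⟨0, fun r _ S _ => .inl ⟨∅, by simp, by simp; omega, by simp⟩⟩
  | succ n ih =>
    rcases s with _ | s
    · exact ⟨0, fun r _ S _ => .inl ⟨∅, by simp, by simp, by simp⟩⟩
    rcases t with _ | t
    · exact ⟨0, fun r _ S _ => .inr ⟨∅, by simp, by simp, by simp⟩⟩
    obtain ⟨R₁, h₁⟩ := ih s (t + 1) (by omega)
    obtain ⟨R₂, h₂⟩ := ih (s + 1) t (by omega)
    refine ⟨R₁ + R₂ + 1, fun r hr S hS => ?_⟩
    obtain ⟨x, hx⟩ : S.Nonempty := Finset.card_pos.1 (by omega)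
    have hcard := Finset.card_filter_add_card_filter_not (s := S.erase x) (fun y => r x y)
    rw [Finset.card_erase_of_mem hx] at hcard
    rcases (by omega : R₁ ≤ ((S.erase x).filter fun y => r x y).card ∨
        R₂ ≤ ((S.erase x).filter fun y => ¬ r x y).card) with h | h
    · rcases h₁ r hr _ h with ⟨T, hT, hc, hcl⟩ | ⟨T, hT, hc, hcl⟩
      · left
        have hxT : x ∉ T := fun h => by simpa using hT h
        have hxr : ∀ y ∈ T, r x y := fun y hy => (Finset.mem_filter.1 (hT hy)).2
        refine ⟨insert x T, Finset.insert_subset hx fun y hy =>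
          Finset.mem_of_mem_erase (Finset.mem_filter.1 (hT hy)).1,
          by rw [Finset.card_insert_of_notMem hxT, hc], ?_⟩
        intro y hy z hz hyz
        rcases Finset.mem_insert.1 hy with rfl | hyT <;>
          rcases Finset.mem_insert.1 hz with rfl | hzT
        · exact absurd rfl hyz
        · exact hxr z hzT
        · exact hr _ _ (hxr y hyT)
        · exact hcl y hyT z hzT hyz
      · exact .inr ⟨T, fun y hy => Finset.mem_of_mem_erase (Finset.mem_filter.1 (hT hy)).1, hc, hcl⟩
    · rcases h₂ r hr _ h with ⟨T, hT, hc, hcl⟩ | ⟨T, hT, hc, hcl⟩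
      · exact .inl ⟨T, fun y hy => Finset.mem_of_mem_erase (Finset.mem_filter.1 (hT hy)).1, hc, hcl⟩
      · right
        have hxT : x ∉ T := fun h => by simpa using hT h
        have hxr : ∀ y ∈ T, ¬ r x y := fun y hy => (Finset.mem_filter.1 (hT hy)).2
        refine ⟨insert x T, Finset.insert_subset hx fun y hy =>
          Finset.mem_of_mem_erase (Finset.mem_filter.1 (hT hy)).1,
          by rw [Finset.card_insert_of_notMem hxT, hc], ?_⟩
        intro y hy z hz hyz
        rcases Finset.mem_insert.1 hy with rfl | hyT <;>
          rcases Finset.mem_insert.1 hz with rfl | hzT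
        · exact absurd rfl hyz
        · exact hxr z hzT
        · exact fun h => hxr y hyT (hr _ _ h)
        · exact hcl y hyT z hzT hyz

/-! ### Averaging the weight over tuples and the upper bound for the density -/

instance : Finite EdgeColour :=
  Finite.of_injective (fun c : EdgeColour => (EdgeColour.rec 0 1 2 c : Fin 3)) (by
    rintro (_ | _ | _) (_ | _ | _) h <;> first | rfl | simp at h)

theorem SimpleGraph.two_mul_ncard_edgeSet {V : Type*} [Fintype V] (G : SimpleGraph V)
    [DecidableRel G.Adj] :
    2 * (G.edgeSet.ncard : ℝ) = ∑ u, ∑ v, if G.Adj u v then (1 : ℝ) else 0 := by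
  classical
  have h := G.sum_degrees_eq_twice_card_edges
  rw [← SimpleGraph.coe_edgeFinset, Set.ncard_coe_finset]
  have h' : (2 : ℝ) * (G.edgeFinset.card : ℝ) = ∑ u, (G.degree u : ℝ) := by exact_mod_cast h.symm
  rw [h']
  refine Finset.sum_congr rfl fun u _ => ?_
  rw [Finset.sum_boole, ← SimpleGraph.card_neighborFinset_eq_degree,
    SimpleGraph.neighborFinset_eq_filter]

namespace Igraph

open Classical in
/-- The `p`-weight of a pair of vertices, which is zero on the diagonal. -/
noncomputable def pairWeight {V : Type*} (p : ℝ) (C : Igraph V) (u v : V) : ℝ :=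
  if u = v then 0 else (C.colour u v).weight p

theorem pairWeight_le_one {V : Type*} {p : ℝ} (hp0 : 0 < p) (hp1 : p < 1) (C : Igraph V)
    (u v : V) : C.pairWeight p u v ≤ 1 := by
  unfold pairWeight; split_ifs
  exacts [zero_le_one, EdgeColour.weight_le_one hp0 hp1 _]

/-- A green edge lies in both graphs and so contributes `p + (1 - p) = 1`. -/
theorem two_mul_pWeight {V : Type*} [Fintype V] (p : ℝ) (C : Igraph V) :
    2 * C.pWeight p = ∑ u, ∑ v, C.pairWeight p u v := by
  classical
  have hr := C.redGraph.two_mul_ncard_edgeSet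
  have hb := C.blueGraph.two_mul_ncard_edgeSet
  have : 2 * C.pWeight p = p * (2 * (C.redGraph.edgeSet.ncard : ℝ)) +
      (1 - p) * (2 * (C.blueGraph.edgeSet.ncard : ℝ)) := by unfold pWeight; ring
  rw [this, hr, hb]
  simp only [Finset.mul_sum, ← Finset.sum_add_distrib]
  refine Finset.sum_congr rfl fun u _ => Finset.sum_congr rfl fun v _ => ?_
  by_cases h : u = v
  · simp [pairWeight, h, redGraph, blueGraph]
  · cases hc : C.colour u v <;> simp [pairWeight, h, redGraph, blueGraph, hc, EdgeColour.weight]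

theorem pWeight_nonneg {V : Type*} {p : ℝ} (hp0 : 0 < p) (hp1 : p < 1) (C : Igraph V) :
    0 ≤ C.pWeight p := by
  have : 0 < 1 - p := by linarith
  unfold pWeight; positivity

end Igraph

theorem le_kex {U : Type*} {p : ℝ} (hp0 : 0 < p) (hp1 : p < 1) {H : SimpleGraph U} {n : ℕ}
    {C : Igraph (Fin n)} (hC : ¬ C.Contains H) : C.pWeight p ≤ kex p H n := by
  -- Any upper bound will do; it is needed for the supremum to be a genuine one.
  refine le_csSup ⟨(n : ℝ) ^ 2, ?_⟩ ⟨C, hC, rfl⟩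
  rintro _ ⟨D, -, rfl⟩
  have h1 := D.two_mul_pWeight p
  have h2 : ∑ u, ∑ v, D.pairWeight p u v ≤ ∑ _u : Fin n, ∑ _v : Fin n, (1 : ℝ) :=
    Finset.sum_le_sum fun u _ => Finset.sum_le_sum fun v _ => D.pairWeight_le_one hp0 hp1 u v
  have h3 := D.pWeight_nonneg hp0 hp1
  simp at h2
  nlinarith

theorem sum_apply_pair {ι α : Type*} [DecidableEq ι] [Fintype ι] [Fintype α] {i j : ι}
    (hij : i ≠ j) (g : α → α → ℝ) :
    (Fintype.card α : ℝ) ^ 2 * ∑ f : ι → α, g (f i) (f j) =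
      (Fintype.card α : ℝ) ^ Fintype.card ι * ∑ x, ∑ y, g x y := by
  -- Double counting: `φ` exchanges the free pair with the entries of the tuple at `i` and `j`.
  let φ : (α × α) × (ι → α) → (α × α) × (ι → α) := fun q =>
    ((q.2 i, q.2 j), Function.update (Function.update q.2 i q.1.1) j q.1.2)
  have hφ : Function.Involutive φ := by
    rintro ⟨⟨x, y⟩, f⟩
    refine Prod.ext (Prod.ext ?_ ?_) (funext fun k => ?_)
    · simp [φ, hij]
    · simp [φ]
    · by_cases hkj : k = j
      · subst hkj; simp [φ]
      · by_cases hki : k = i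
        · subst hki; simp [φ, hij]
        · simp [φ, hkj, hki]
  have h := Equiv.sum_comp (hφ.toPerm φ) fun q : (α × α) × (ι → α) => g q.1.1 q.1.2
  have h1 : ∑ q : (α × α) × (ι → α), g (hφ.toPerm φ q).1.1 (hφ.toPerm φ q).1.2 =
      (Fintype.card α : ℝ) ^ 2 * ∑ f : ι → α, g (f i) (f j) := by
    rw [Fintype.sum_prod_type]
    simp [φ, Function.Involutive.toPerm, sq]
  have h2 : ∑ q : (α × α) × (ι → α), g q.1.1 q.1.2 =
      (Fintype.card α : ℝ) ^ Fintype.card ι * ∑ x, ∑ y, g x y := by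
    rw [Fintype.sum_prod_type, Fintype.sum_prod_type]
    simp [Finset.mul_sum]
  rw [← h1, ← h2, h]

namespace Igraph

/-- The total `p`-weight of the ordered pairs of entries of a tuple of vertices. -/
noncomputable def tupleWeight {V : Type*} (p : ℝ) (C : Igraph V) {N : ℕ} (f : Fin N → V) : ℝ :=
  ∑ i, ∑ j ∈ Finset.univ.erase i, C.pairWeight p (f i) (f j)

theorem sum_erase_const (N : ℕ) (c : ℝ) :
    ∑ i : Fin N, ∑ _j ∈ Finset.univ.erase i, c = N * (N - 1) * c := by
  have h : ∀ i : Fin N, ∑ _j ∈ Finset.univ.erase i, c = (N - 1) * c := by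
    intro i
    have : 1 ≤ N := by have := i.2; omega
    rw [Finset.sum_const, Finset.card_erase_of_mem (Finset.mem_univ _), Finset.card_univ,
      Fintype.card_fin, nsmul_eq_mul, Nat.cast_sub this, Nat.cast_one]
  simp only [h]
  simp
  ring

theorem tupleWeight_le {V : Type*} {p : ℝ} (hp0 : 0 < p) (hp1 : p < 1) (C : Igraph V) {N : ℕ}
    (f : Fin N → V) : C.tupleWeight p f ≤ N * (N - 1) := by
  have := sum_erase_const N 1
  rw [mul_one] at this
  rw [← this]
  exact Finset.sum_le_sum fun i _ => Finset.sum_le_sum fun j _ => C.pairWeight_le_one hp0 hp1 _ _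

theorem sum_tupleWeight (p : ℝ) {n : ℕ} (C : Igraph (Fin n)) (N : ℕ) :
    (n : ℝ) ^ 2 * ∑ f : Fin N → Fin n, C.tupleWeight p f =
      N * (N - 1) * ((n : ℝ) ^ N * (2 * C.pWeight p)) := by
  rw [← sum_erase_const, C.two_mul_pWeight]
  unfold tupleWeight
  rw [Finset.sum_comm, Finset.mul_sum]
  refine Finset.sum_congr rfl fun i _ => ?_
  rw [Finset.sum_comm, Finset.mul_sum]
  refine Finset.sum_congr rfl fun j hj => ?_
  have := sum_apply_pair (ι := Fin N) (α := Fin n) (Finset.ne_of_mem_erase hj).symm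
    (C.pairWeight p)
  simpa using this

/-- An igraph of weight density above `κ + ε` has many `N`-tuples of weight density at least
`κ + ε / 2`. -/
theorem card_tupleWeight_ge {p : ℝ} (hp0 : 0 < p) (hp1 : p < 1) {κ ε : ℝ} (hκ : 0 ≤ κ)
    (hε : 0 < ε) {n N : ℕ} (hN : 2 ≤ N) (hn : 4 * (κ + ε + N ^ 2) ≤ ε * n)
    (C : Igraph (Fin n)) (hC : (κ + ε) * n.choose 2 < C.pWeight p) :
    ε / 4 * (n : ℝ) ^ N ≤ ({f : Fin N → Fin n | Function.Injective f ∧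
      (N : ℝ) * (N - 1) * (κ + ε / 2) ≤ C.tupleWeight p f}.ncard : ℝ) := by
  classical
  have hN' : (2 : ℝ) ≤ N := by exact_mod_cast hN
  have hn0 : (0 : ℝ) < n := by
    by_contra! h
    have : ε * n ≤ 0 := mul_nonpos_of_nonneg_of_nonpos hε.le h
    nlinarith
  set M : ℝ := N * (N - 1) with hM
  have hM0 : 0 < M := mul_pos (by linarith) (by linarith)
  set G : Finset (Fin N → Fin n) := Finset.univ.filter fun f => Function.Injective f ∧
    M * (κ + ε / 2) ≤ C.tupleWeight p f with hG
  set I : Finset (Fin N → Fin n) := Finset.univ.filter fun f => ¬ Function.Injective f with hI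
  have hset : {f : Fin N → Fin n | Function.Injective f ∧
      M * (κ + ε / 2) ≤ C.tupleWeight p f} = (G : Set (Fin N → Fin n)) := by
    ext f; simp [hG]
  rw [hset, Set.ncard_coe_finset]
  have hIle : (n : ℝ) * I.card ≤ N ^ 2 * (n : ℝ) ^ N := by
    have := card_mul_card_not_injective_le (Fin N) (Fin n)
    rw [Fintype.card_fin, Fintype.card_fin] at this
    norm_cast
    convert this
  -- A tuple exceeds the threshold only if it is good or not injective, and then by at most `M`.
  -- Non-injective tuples are few, so a large average needs many good ones.
  have hpt : ∀ f : Fin N → Fin n, C.tupleWeight p f ≤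
      M * (κ + ε / 2) + ((if f ∈ G then M else 0) + if f ∈ I then M else 0) := by
    intro f
    have h1 := C.tupleWeight_le hp0 hp1 f
    have h2 : 0 ≤ M * (κ + ε / 2) := by positivity
    by_cases hf : Function.Injective f
    · by_cases hw : M * (κ + ε / 2) ≤ C.tupleWeight p f
      · simp [hG, hI, hf, hw]; linarith
      · simp [hG, hI, hf, hw]; linarith
    · simp [hG, hI, hf]; linarith
  have hsum := Finset.sum_le_sum fun f (_ : f ∈ Finset.univ) => hpt f
  rw [Finset.sum_add_distrib, Finset.sum_add_distrib, Finset.sum_ite_mem, Finset.sum_ite_mem,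
    Finset.univ_inter, Finset.univ_inter] at hsum
  simp only [Finset.sum_const, Finset.card_univ, Fintype.card_fun, Fintype.card_fin,
    nsmul_eq_mul, Nat.cast_pow] at hsum
  have htot := C.sum_tupleWeight p N
  rw [← hM] at htot
  rw [Nat.cast_choose_two] at hC
  have hnN : (0 : ℝ) < (n : ℝ) ^ N := by positivity
  have h1 : (n : ℝ) ^ N * M * ((κ + ε) * (n * (n - 1))) ≤
      (n : ℝ) ^ 2 * ((n : ℝ) ^ N * (M * (κ + ε / 2)) + (G.card * M + I.card * M)) := by
    refine le_trans ?_ (mul_le_mul_of_nonneg_left hsum (by positivity))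
    rw [htot]
    have : (κ + ε) * (n * (n - 1)) ≤ 2 * C.pWeight p := by linarith
    have := mul_le_mul_of_nonneg_left this (by positivity : 0 ≤ (n : ℝ) ^ N * M)
    linarith
  have h2 : (n : ℝ) ^ N * ((κ + ε) * (n - 1)) ≤
      n * ((n : ℝ) ^ N * (κ + ε / 2) + (G.card + I.card)) := by
    have hpos : 0 < (n : ℝ) * M := by positivity
    refine le_of_mul_le_mul_left ?_ hpos
    linarith
  have h3 : (n : ℝ) ^ N * (4 * (κ + ε + N ^ 2)) ≤ (n : ℝ) ^ N * (ε * n) :=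
    mul_le_mul_of_nonneg_left hn hnN.le
  refine le_of_mul_le_mul_left ?_ hn0
  linarith

/-- Parts of an igraph that realise a blowup of a type, up to replacing edges by green ones. -/
theorem contains_of_describes {V U : Type*} [Fintype U] {N : ℕ} {C : Igraph V} {τ : IType (Fin N)}
    (t : Fin N → (Fin (Fintype.card U) ↪ V))
    (hne : ∀ i j x y, i ≠ j → t i x ≠ t j y ∧ C.colour (t i x) (t j y) = τ.colour i j)
    (hred : ∀ i x y, x ≠ y → τ.vertexColour i = .red →
      C.colour (t i x) (t i y) = .red ∨ C.colour (t i x) (t i y) = .green)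
    (hblue : ∀ i x y, x ≠ y → τ.vertexColour i = .blue →
      C.colour (t i x) (t i y) = .blue ∨ C.colour (t i x) (t i y) = .green)
    {H : SimpleGraph U} (h : τ.Describes H) : C.Contains H := by
  obtain ⟨g, h1, h2⟩ := (IType.describes_iff _ _).1 h
  let e := Fintype.equivFin U
  have hinj : Function.Injective fun u => t (g u) (e u) := by
    intro u v huv
    by_cases hg : g u = g v
    · simp only [hg] at huv
      exact e.injective ((t (g v)).injective huv)
    · exact absurd huv (hne _ _ _ _ hg).1
  refine ⟨⟨_, hinj⟩, fun u v huv => ⟨hinj.ne huv.ne, ?_⟩, fun u v huv => ⟨hinj.ne huv.ne, ?_⟩⟩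
  · have hc := h1 u v huv
    simp only [Function.Embedding.coeFn_mk]
    by_cases hg : g u = g v
    · rw [hg, IType.partColour_self] at hc
      rw [hg]
      cases hv : τ.vertexColour (g v)
      · exact hred _ _ _ (e.injective.ne huv.ne) hv
      · simp [hv, VertexColour.toEdgeColour] at hc
    · rw [(hne _ _ _ _ hg).2]
      rwa [IType.partColour_of_ne _ hg] at hc
  · have hc := h2 u v huv
    simp only [Function.Embedding.coeFn_mk]
    by_cases hg : g u = g v
    · rw [hg, IType.partColour_self] at hc
      rw [hg]
      cases hv : τ.vertexColour (g v)
      · simp [hv, VertexColour.toEdgeColour] at hc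
      · exact hblue _ _ _ (e.injective.ne huv.ne) hv
    · rw [(hne _ _ _ _ hg).2]
      rwa [IType.partColour_of_ne _ hg] at hc

/-- If no type of `p`-value above `κ` fails to describe `H`, then large `H`-free igraphs have weight
density at most `κ + ε`. -/
theorem pWeight_le_of_not_contains {U : Type*} [Finite U] {p : ℝ} (hp0 : 0 < p) (hp1 : p < 1)
    {H : SimpleGraph U} {κ : ℝ} (hκ : 0 ≤ κ)
    (hmax : ∀ (N : ℕ) [NeZero N] (τ : IType (Fin N)), ¬ τ.Describes H → τ.pValue p ≤ κ)
    {ε : ℝ} (hε : 0 < ε) :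
    ∃ n₀ : ℕ, ∀ n, n₀ ≤ n → ∀ C : Igraph (Fin n), ¬ C.Contains H →
      C.pWeight p ≤ (κ + ε) * n.choose 2 := by
  classical
  have := Fintype.ofFinite U
  -- The inequality says `κ * N < (N - 1) * (κ + ε / 2)`: passing from density among distinct pairs
  -- to the quadratic form, diagonal included, still leaves more than `κ`.
  obtain ⟨N, hN⟩ : ∃ N : ℕ, 2 ≤ N ∧ κ + ε / 2 < N * (ε / 2) := by
    obtain ⟨N, hN⟩ := exists_nat_gt ((κ + ε / 2) / (ε / 2))
    refine ⟨N + 2, by omega, ?_⟩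
    rw [div_lt_iff₀ (by positivity)] at hN
    push_cast
    linarith
  obtain ⟨hN2, hNκ⟩ := hN
  have : NeZero N := ⟨by omega⟩
  have hN' : (2 : ℝ) ≤ N := by exact_mod_cast hN2
  have := Fintype.ofFinite EdgeColour
  set P := Fin N → Fin N → EdgeColour
  have hP0 : Nonempty P := ⟨fun _ _ => .green⟩
  have hP : (0 : ℝ) < Fintype.card P := by exact_mod_cast Fintype.card_pos
  set δ : ℝ := ε / 4 / Fintype.card P with hδ
  have hδ0 : 0 < δ := by positivity
  obtain ⟨R, hR⟩ := exists_clique_or_indep (Fintype.card U) (Fintype.card U)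
  obtain ⟨n₁, hn₁⟩ := exists_box_of_dense N R δ hδ0
  obtain ⟨n₂, hn₂⟩ := exists_nat_gt (4 * (κ + ε + N ^ 2) / ε)
  refine ⟨max (max n₁ n₂) 1, fun n hn C hC => ?_⟩
  by_contra! hw
  have hn0 : (0 : ℝ) < n := by exact_mod_cast (by omega : 0 < n)
  have hnε : 4 * (κ + ε + N ^ 2) ≤ ε * n := by
    rw [div_lt_iff₀' hε] at hn₂
    exact hn₂.le.trans (mul_le_mul_of_nonneg_left (by exact_mod_cast (by omega)) hε.le)
  have hG := C.card_tupleWeight_ge hp0 hp1 hκ hε hN2 hnε hw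
  set G : Set (Fin N → Fin n) := {f | Function.Injective f ∧
      (N : ℝ) * (N - 1) * (κ + ε / 2) ≤ C.tupleWeight p f} with hGdef
  let pat : (Fin N → Fin n) → P := fun f i j => C.colour (f i) (f j)
  obtain ⟨c, hc⟩ : ∃ c : P, δ * (n : ℝ) ^ N ≤ ({f | f ∈ G ∧ pat f = c}.ncard : ℝ) := by
    by_contra! hcon
    have h1 : G.ncard = ∑ c : P, {f | f ∈ G ∧ pat f = c}.ncard := by
      rw [Set.ncard_eq_toFinset_card' G,
        Finset.card_eq_sum_card_fiberwise (f := pat) (t := Finset.univ) (by simp)]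
      refine Finset.sum_congr rfl fun c _ => ?_
      rw [Set.ncard_eq_toFinset_card']
      congr 1
      ext f; simp
    have h2 : (G.ncard : ℝ) = ∑ c : P, ({f | f ∈ G ∧ pat f = c}.ncard : ℝ) := by exact_mod_cast h1
    have h3 := Finset.sum_lt_sum_of_nonempty (s := (Finset.univ : Finset P))
      ⟨Classical.arbitrary P, by simp⟩ (fun c _ => hcon c)
    rw [← h2, Finset.sum_const, Finset.card_univ, nsmul_eq_mul, hδ, ← mul_assoc,
      mul_div_cancel₀ _ hP.ne'] at h3
    exact absurd hG (not_le.2 h3)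
  obtain ⟨A, hA⟩ := hn₁ n (by omega) _ hc
  obtain ⟨f₀, hf₀⟩ : {f | f ∈ G ∧ pat f = c}.Nonempty := by
    refine (Set.ncard_pos (Set.toFinite _)).1 ?_
    have : (0 : ℝ) < ({f | f ∈ G ∧ pat f = c}.ncard : ℝ) := lt_of_lt_of_le (by positivity) hc
    exact_mod_cast this
  -- The box theorem does not make the sides disjoint; this comes from the injectivity of the tuples
  -- in `G`.
  have hbox : ∀ i j x y, i ≠ j → A i x ≠ A j y ∧
      C.colour (A i x) (A j y) = C.colour (f₀ i) (f₀ j) := by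
    intro i j x y hij
    have h := hA (Function.update (fun _ => x) j y)
    have hi : A i (Function.update (fun _ => x) j y i) = A i x := by simp [hij]
    have hj : A j (Function.update (fun _ => x) j y j) = A j y := by simp
    refine ⟨?_, ?_⟩
    · rw [← hi, ← hj]
      exact h.1.1.ne hij
    · rw [← hi, ← hj]
      exact congrFun (congrFun (h.2.trans hf₀.2.symm) i) j
  -- Ramsey inside each side: a clique of red or green edges stands for a red vertex, its
  -- alternative has only blue edges and stands for a blue one.
  have hram : ∀ i, ∃ (v : VertexColour) (t : Fin (Fintype.card U) ↪ Fin n),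
      (∀ x, ∃ y, t x = A i y) ∧
      (v = .red → ∀ x y, x ≠ y → C.colour (t x) (t y) = .red ∨ C.colour (t x) (t y) = .green) ∧
      (v = .blue → ∀ x y, x ≠ y →
        C.colour (t x) (t y) = .blue ∨ C.colour (t x) (t y) = .green) := by
    intro i
    have hmem : ∀ T : Finset (Fin n), T ⊆ Finset.univ.map (A i) →
        ∀ hT : T.card = Fintype.card U, ∀ x, ∃ y, T.orderEmbOfFin hT x = A i y := by
      intro T hT hc x
      obtain ⟨y, -, hy⟩ := Finset.mem_map.1 (hT (T.orderEmbOfFin_mem hc x))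
      exact ⟨y, hy.symm⟩
    rcases hR (fun x y => C.colour x y = .red ∨ C.colour x y = .green)
      (fun x y h => by rwa [C.symm]) (Finset.univ.map (A i)) (by simp) with
      ⟨T, hT, hcard, hcl⟩ | ⟨T, hT, hcard, hcl⟩
    · exact ⟨.red, (T.orderEmbOfFin hcard).toEmbedding, hmem T hT hcard,
        fun _ x y hxy => hcl _ (T.orderEmbOfFin_mem hcard x) _ (T.orderEmbOfFin_mem hcard y)
          ((T.orderEmbOfFin hcard).injective.ne hxy), fun h => by simp at h⟩
    · refine ⟨.blue, (T.orderEmbOfFin hcard).toEmbedding, hmem T hT hcard, fun h => by simp at h,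
        fun _ x y hxy => ?_⟩
      have := hcl _ (T.orderEmbOfFin_mem hcard x) _ (T.orderEmbOfFin_mem hcard y)
          ((T.orderEmbOfFin hcard).injective.ne hxy)
      show C.colour (T.orderEmbOfFin hcard x) (T.orderEmbOfFin hcard y) = .blue ∨ _
      cases hcol : C.colour (T.orderEmbOfFin hcard x) (T.orderEmbOfFin hcard y) <;> simp_all
  choose v t ht hred hblue using hram
  let τ : IType (Fin N) :=
    { colour := fun i j => C.colour (f₀ i) (f₀ j)
      symm := fun i j => C.symm _ _
      vertexColour := v }
  have hτ : ¬ τ.Describes H := fun h => hC <| contains_of_describes (τ := τ) t (by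
      intro i j x y hij
      obtain ⟨x', hx'⟩ := ht i x
      obtain ⟨y', hy'⟩ := ht j y
      rw [hx', hy']
      exact hbox i j x' y' hij)
    (fun i x y hxy hv => hred i hv x y hxy) (fun i x y hxy hv => hblue i hv x y hxy) h
  -- The uniform vector turns the weight of the tuple `f₀` into a lower bound for the value of `τ`.
  have hx : (fun _ : Fin N => 1 / (N : ℝ)) ∈ stdSimplex ℝ (Fin N) :=
    ⟨fun _ => by positivity, by simp⟩
  have h1 := (IType.quadForm_le_pValue (p := p) (τ := τ) hx).trans (hmax N τ hτ)
  have h2 : C.tupleWeight p f₀ ≤ ∑ i, ∑ j, τ.weightMatrix p i j := by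
    refine Finset.sum_le_sum fun i _ => ?_
    rw [← Finset.add_sum_erase _ _ (Finset.mem_univ i)]
    have h0 : 0 ≤ τ.weightMatrix p i i := by
      rw [IType.weightMatrix_apply]; exact EdgeColour.weight_nonneg hp0 hp1 _
    refine le_trans (Finset.sum_le_sum fun j hj => le_of_eq ?_) (le_add_of_nonneg_left h0)
    have hij := (Finset.ne_of_mem_erase hj).symm
    rw [IType.weightMatrix_of_ne _ _ hij]
    simp [pairWeight, hf₀.1.1.ne hij, τ]
  have h3 : (fun _ : Fin N => 1 / (N : ℝ)) ⬝ᵥ (τ.weightMatrix p).mulVec (fun _ => 1 / (N : ℝ)) =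
      (∑ i, ∑ j, τ.weightMatrix p i j) / (N : ℝ) ^ 2 := by
    simp only [dotProduct, Matrix.mulVec, ← Finset.sum_mul, ← Finset.mul_sum]
    field_simp
  rw [h3, div_le_iff₀ (by positivity)] at h1
  have h4 := hf₀.1.2.trans (h2.trans h1)
  have h5 : ((N : ℝ) - 1) * (κ + ε / 2) ≤ κ * N := by
    refine le_of_mul_le_mul_left ?_ (by linarith : (0 : ℝ) < N)
    linarith
  linarith

/-! ### Balanced blowups of green types and the lower bound -/

/-- The `n`-vertex igraph with `k` balanced parts, edges of colour `c` inside the parts and green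
edges between them. -/
def residue (n k : ℕ) (c : VertexColour) : Igraph (Fin n) where
  colour u v := if (u : ℕ) % k = v % k then c.toEdgeColour else .green
  symm u v := by simp only [eq_comm]

theorem describes_green_of_contains_residue {U : Type*} [Finite U] {n k : ℕ} (hk : 0 < k)
    {c : VertexColour} {H : SimpleGraph U} (h : (residue n k c).Contains H) :
    (IType.green k c).Describes H := by
  obtain ⟨f, h1, h2⟩ := h
  let g : U → Fin k := fun u => ⟨f u % k, Nat.mod_lt _ hk⟩
  have hg : ∀ u v, (IType.green k c).partColour (g u) (g v) =
      (residue n k c).colour (f u) (f v) := by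
    intro u v
    by_cases h : (f u : ℕ) % k = f v % k
    · have : g u = g v := Fin.ext h
      rw [this, IType.partColour_self]
      simp [residue, h, IType.green]
    · have : g u ≠ g v := fun h' => h (congrArg Fin.val h')
      rw [IType.partColour_of_ne _ this]
      simp [residue, h, IType.green]
  exact (IType.describes_iff _ _).2
    ⟨g, fun u v huv => hg u v ▸ (h1 u v huv).2, fun u v huv => hg u v ▸ (h2 u v huv).2⟩

theorem card_mod_eq_le (n k r : ℕ) :
    (Finset.univ.filter fun v : Fin n => (v : ℕ) % k = r).card ≤ n / k + 1 := by
  rw [← Finset.card_range (n / k + 1)]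
  refine Finset.card_le_card_of_injOn (fun v => (v : ℕ) / k) ?_ ?_
  · intro v _
    simp only [Finset.coe_range, Set.mem_Iio, Nat.lt_succ_iff]
    exact Nat.div_le_div_right v.2.le
  · intro u hu v hv huv
    simp only [Finset.coe_filter, Finset.mem_univ, true_and, Set.mem_ofPred_eq] at hu hv
    refine Fin.ext ?_
    rw [← Nat.div_add_mod u k, ← Nat.div_add_mod v k, hu, hv]
    simp only at huv
    rw [huv]

theorem le_pWeight_residue {p : ℝ} (n k : ℕ) {c : VertexColour} (hc : c.weight p ≤ 1) :
    (n : ℝ) * (n - 1) - (1 - c.weight p) * (n * (n / k)) ≤ 2 * (residue n k c).pWeight p := by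
  have hpt : ∀ u v : Fin n, (residue n k c).pairWeight p u v =
      1 - (1 - c.weight p) * (if (v : ℕ) % k = u % k then 1 else 0) -
        (if v = u then c.weight p else 0) := by
    intro u v
    have hw : c.toEdgeColour.weight p = c.weight p := by cases c <;> rfl
    by_cases huv : u = v
    · subst huv; simp [pairWeight]
    · by_cases h : (u : ℕ) % k = v % k
      · simp [pairWeight, residue, huv, Ne.symm huv, h, hw]
      · simp [pairWeight, residue, huv, Ne.symm huv, h, Ne.symm h, EdgeColour.weight]
  have hrow : ∀ u : Fin n, (n : ℝ) - 1 - (1 - c.weight p) * (n / k) ≤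
      ∑ v, (residue n k c).pairWeight p u v := by
    intro u
    simp only [hpt, Finset.sum_sub_distrib, ← Finset.mul_sum, Finset.sum_boole]
    -- The rounding error `+ 1` and the diagonal term together cost exactly `1`, giving `n - 1` in
    -- the row bound.
    have h1 : ((Finset.univ.filter fun v : Fin n => (v : ℕ) % k = u % k).card : ℝ) ≤ n / k + 1 := by
      have h2 : ((Finset.univ.filter fun v : Fin n => (v : ℕ) % k = u % k).card : ℝ) ≤
          ((n / k + 1 : ℕ) : ℝ) := by exact_mod_cast card_mod_eq_le n k (u % k)
      have h3 : ((n / k : ℕ) : ℝ) ≤ (n : ℝ) / k := Nat.cast_div_le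
      push_cast at h2
      linarith
    have h4 := mul_le_mul_of_nonneg_left h1 (sub_nonneg.2 hc)
    simp
    linarith
  rw [two_mul_pWeight]
  have h := Finset.sum_le_sum fun u (_ : u ∈ Finset.univ) => hrow u
  rw [Finset.sum_const, Finset.card_univ, Fintype.card_fin, nsmul_eq_mul] at h
  linarith

end Igraph

/-! ### Convergence of the density and the conclusion -/

/-- The blowups of a green type give a lower bound for the density of `H`-free igraphs. -/
theorem eventually_lt_kex_div {U : Type*} [Finite U] {p : ℝ} (hp0 : 0 < p) (hp1 : p < 1)
    {H : SimpleGraph U} {k : ℕ} (hk : 0 < k) {c : VertexColour}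
    (hH : ¬ (IType.green k c).Describes H) {l : ℝ} (hl : l < 1 - (1 - c.weight p) / k) :
    ∀ᶠ n : ℕ in Filter.atTop, l < kex p H n / (n.choose 2 : ℝ) := by
  have hc : c.weight p ≤ 1 := by cases c <;> simp [VertexColour.weight] <;> linarith
  have hk' : (0 : ℝ) < k := by exact_mod_cast hk
  set q := (1 - c.weight p) / k with hq
  have hd : 0 < 1 - q - l := by linarith
  -- The required inequality `l * n * (n - 1) < n * (n - 1) - q * n ^ 2` amounts to `q < (n - 1) *
  -- (1 - q - l)`.
  obtain ⟨n₀, hn₀⟩ := exists_nat_gt (q / (1 - q - l))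
  filter_upwards [Filter.eventually_ge_atTop (n₀ + 2)] with n hn
  have hn' : (n₀ : ℝ) + 2 ≤ n := by exact_mod_cast hn
  have hn0 : (0 : ℝ) ≤ n₀ := Nat.cast_nonneg _
  rw [div_lt_iff₀ hd] at hn₀
  have h1 := le_kex hp0 hp1 fun h => hH (Igraph.describes_green_of_contains_residue (n := n) hk h)
  have h2 := Igraph.le_pWeight_residue (p := p) n k hc
  have h3 : (1 - c.weight p) * (n * (n / k)) = q * (n * n) := by rw [hq]; field_simp
  rw [h3] at h2
  rw [Nat.cast_choose_two, lt_div_iff₀ (by nlinarith)]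
  have h4 : (n₀ : ℝ) * (1 - q - l) ≤ (n - 1) * (1 - q - l) :=
    mul_le_mul_of_nonneg_right (by linarith) hd.le
  have h5 : 0 < (n : ℝ) * ((n - 1) * (1 - q - l) - q) := mul_pos (by linarith) (by linarith)
  linarith

theorem eventually_kex_div_lt {U : Type*} [Finite U] {p : ℝ} (hp0 : 0 < p) (hp1 : p < 1)
    {H : SimpleGraph U} {κ : ℝ} (hκ : 0 ≤ κ)
    (hmax : ∀ (N : ℕ) [NeZero N] (τ : IType (Fin N)), ¬ τ.Describes H → τ.pValue p ≤ κ)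
    {l : ℝ} (hl : κ < l) : ∀ᶠ n : ℕ in Filter.atTop, kex p H n / (n.choose 2 : ℝ) < l := by
  obtain ⟨n₀, hn₀⟩ := Igraph.pWeight_le_of_not_contains hp0 hp1 hκ hmax
    (by linarith : 0 < (l - κ) / 2)
  filter_upwards [Filter.eventually_ge_atTop (n₀ + 2)] with n hn
  have hch : (0 : ℝ) < n.choose 2 := by exact_mod_cast Nat.choose_pos (by omega)
  rw [div_lt_iff₀ hch]
  have hle : kex p H n ≤ (κ + (l - κ) / 2) * n.choose 2 := by
    -- The nonnegative bound also covers an empty set of igraphs, whose `sSup` is `0`.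
    refine Real.sSup_le ?_ (mul_nonneg (by linarith) hch.le)
    rintro _ ⟨C, hC, rfl⟩
    exact hn₀ n (by omega) C hC
  refine hle.trans_lt (mul_lt_mul_of_pos_right (by linarith) hch)

theorem isInducedDensity_eye {a b : ℕ} (ha : 2 ≤ a) (hb : 2 ≤ b) {p : ℝ} (hp0 : 0 < p)
    (hp1 : p < 1) :
    IsInducedDensity p (eye a b)
      (max (1 - p / (a : ℝ)) (1 - (1 - p) / ((b : ℝ) - 1))) := by
  have ha' : (2 : ℝ) ≤ a := by exact_mod_cast ha
  refine tendsto_order.2 ⟨fun l hl => ?_, fun l hl => ?_⟩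
  · rcases lt_max_iff.1 hl with hl | hl
    · refine eventually_lt_kex_div hp0 hp1 (by omega)
        ((IType.isGreen_green a .blue).not_describes_eye_of_blue (by simp) (by omega)) ?_
      simpa [VertexColour.weight] using hl
    · refine eventually_lt_kex_div hp0 hp1 (by omega : 0 < b - 1)
        ((IType.isGreen_green (b - 1) .red).not_describes_eye_of_red (by simp; omega)) ?_
      rw [Nat.cast_sub (by omega), Nat.cast_one]
      exact hl
  · refine eventually_kex_div_lt hp0 hp1 (le_max_of_le_left ?_)
      (fun N _ τ hτ => IType.pValue_le_of_not_describes_eye hp0 hp1 ha hb hτ) hl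
    have : p / a ≤ 1 := (div_le_one (by linarith)).2 (by linarith)
    linarith

theorem lemma2p9 (a b : ℕ) (ha : 2 ≤ a) (hb : 2 ≤ b) (p : ℝ) (hp0 : 0 < p) (hp1 : p < 1) :
    (∀ {V : Type*} [Fintype V] [Nonempty V] (τ : IType V),
      τ.IsMaxCoreNotDescribing p (eye a b) →
        τ.Isomorphic (IType.greenType 0 a) ∨ τ.Isomorphic (IType.greenType (b - 1) 0)) ∧
    IsInducedDensity p (eye a b)
      (max (1 - p / (a : ℝ)) (1 - (1 - p) / ((b : ℝ) - 1))) :=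
  ⟨fun _ hτ => hτ.isomorphic_greenType hp0 hp1 ha hb, isInducedDensity_eye ha hb hp0 hp1⟩
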